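/- **Setting.** Let $\mathcal G=(V,E)$ be a finite symmetric directed graph without loops ($(i,j)\in E\Rightarrow (j,i)\in E$), $m=|E|$; let $d\ge 2$, let $\mathcal X\subset\mathbb R^d$ be a finite nonempty set of node-arms and $\mathbf M_\star\in\mathbb R^{d\times d}$ an unknown matrix. Put $z_{xx'}=\mathrm{vec}(xx'^{\top})\in\mathbb R^{d^2}$ and $\theta_\star=\mathrm{vec}(\mathbf M_\star)$, so $\langle z_{xx'},\theta_\star\rangle=x^\top\mathbf M_\star x'$. Assume $\|z_{xx'}\|_2\le L$ and $\langle z_{xx'},\theta_\star\rangle\ge 0$ for all $x,x'\in\mathcal X$, and $\|\mathbf M_\star\|_F\le S$ (hence $0\le\langle z_{xx'},\theta_\star\rangle\le LS$). If the joint arm $(x^{(i)}_t)_{i\in V}\in\mathcal X^V$ is played at round $t$, one observes, for all $(i,j)\in E$, $y^{(i,j)}_t=\langle z^{(i,j)}_t,\theta_\star\rangle+\eta^{(i,j)}_t$ with $z^{(i,j)}_t=z_{x^{(i)}_tx^{(j)}_t}$. The noise is conditionally $\sigma$-sub-Gaussian ($\sigma\ge0$): for a filtration $(\mathcal F_t)$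 such that $\eta_t$ is $\mathcal F_t$-measurable, $\mathbb E[\exp(\sum_{e\in E}c_e\eta^{e}_t)\mid\mathcal F_{t-1}]\le\exp(\sigma^2\sum_e c_e^2/2)$ for all $c\in\mathbb R^E$ (for instance, mean-zero $\sigma$-sub-Gaussian noise independent over edges and rounds). **Algorithm 1.** Fix $\lambda>0$, $\delta\in(0,1]$ and a horizon $T$. First compute a greedy cut $(V_1,V_2)$: starting from $V_1=V_2=\emptyset$, treat the nodes one by one in an arbitrary order, adding a node to $V_2$ if it has strictly more neighbours in $V_1$ than in $V_2$, and to $V_1$ otherwise. With $$\mathbf A_t=\lambda\mathbf I_{d^2}+\sum_{s=1}^t\sum_{e\in E}z^{e}_sz^{e\top}_s,\qquad \hat\theta_t=\mathbf A_t^{-1}\sum_{s=1}^t\sum_{e\in E}y^{e}_sz^{e}_s,$$ $$C_t=\Big\{\theta:\ \|\theta-\hat\theta_t\|_{\mathbf A_t}\le\sigma\sqrt{d^2\log\tfrac{1+tmL^2/\lambda}{\delta}}+\sqrt\lambda S\Big\},\qquad \|v\|_{\mathbf A}=\sqrt{v^\top\mathbf A v},$$ at each round $t=1,\dots,T$ choose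 $(x_t,x'_t,\tilde\theta_{t-1})\in\arg\max_{(x,x',\theta)\in\mathcal X^2\times C_{t-1}}\langle z_{xx'}+z_{x'x},\theta\rangle$, where ties may be broken by any rule that makes $(x_t,x'_t)$ $\mathcal F_{t-1}$-measurable, and play $x_t$ on all nodes of $V_1$ and $x'_t$ on all nodes of $V_2$. **Theorem.** Let $(x^{(i)}_\star)_{i\in V}\in\mathcal X^V$ maximize $\sum_{(i,j)\in E}x^{(i)\top}\mathbf M_\star x^{(j)}$, let $z^{(i,j)}_\star=z_{x_\star^{(i)}x_\star^{(j)}}$, and $$\gamma=\min_{x\in\mathcal X}\frac{\langle z_{xx},\theta_\star\rangle}{\frac1m\sum_{(i,j)\in E}\langle z^{(i,j)}_\star,\theta_\star\rangle}$$ (with $\gamma=0$ if this denominator is $0$ or undefined), $\alpha=\frac{1+\gamma}2$. Then $0\le\gamma\le1$, and for every $T$, with probability at least $1-\delta$, the $\alpha$-regret $R_\alpha(T)=\sum_{t=1}^T\sum_{(i,j)\in E}\big(\alpha\langle z^{(i,j)}_\star,\theta_\star\rangle-\langle z^{(i,j)}_t,\theta_\star\rangle\big)$ of Algorithm 1 satisfies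 $$R_\alpha(T)\le\sqrt{32\,Tm\,d^2\max\big(2,(LS)^2\big)\log\Big(1+\tfrac{TmL^2/\lambda}{d^2}\Big)}\left(\sigma\sqrt{d^2\log\tfrac{1+TmL^2/\lambda}{\delta}}+\sqrt\lambda S\right)+LSm\,\max\Big\{0,\Big\lceil d^2\log_2\tfrac{TmL^2/\lambda}{\delta}\Big\rceil\Big\},$$ where the last term is read as $0$ if $TmL=0$. In particular the first term is $\tilde O\big((\sigma d^2+dS\sqrt\lambda)\sqrt{Tm\max(2,(LS)^2)}\big)$, where $\tilde O$ hides an absolute constant and factors logarithmic in $TmL^2/\lambda$ and $1/\delta$. -/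

import Mathlib

open MeasureTheory
open scoped Matrix

namespace GraphicalBilinearBandit

/-! ### Linear algebra: edge-arms and norms -/

/-- The Euclidean norm of a coordinate vector. -/
noncomputable def euclNorm {ι : Type*} [Fintype ι] (v : ι → ℝ) : ℝ :=
  ‖WithLp.toLp 2 v‖

/-- The Frobenius norm of a square real matrix. -/
noncomputable def frobNorm {d : ℕ} (M : Matrix (Fin d) (Fin d) ℝ) : ℝ :=
  √(∑ i, ∑ j, M i j ^ 2)

/-- `‖v‖_A = √(vᵀ A v)`. -/
noncomputable def weightedNorm {ι : Type*} [Fintype ι] (A : Matrix ι ι ℝ) (v : ι → ℝ) : ℝ :=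
  √(v ⬝ᵥ A *ᵥ v)

/-- The edge-arm `z_{x x'} = vec (x x'ᵀ)` of a pair of node-arms. -/
def edgeArm {d : ℕ} (x x' : Fin d → ℝ) : Fin d × Fin d → ℝ :=
  (Matrix.vecMulVec x x').vec

/-- The expected reward `xᵀ M x'` of one directed edge whose ends play `x` and `x'`. -/
def meanReward {d : ℕ} (M : Matrix (Fin d) (Fin d) ℝ) (x x' : Fin d → ℝ) : ℝ :=
  x ⬝ᵥ M *ᵥ x'

/-- The linear form of the reward: `⟨z_{x x'}, vec M⟩ = xᵀ M x'`. -/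
theorem edgeArm_dotProduct_vec {d : ℕ} (M : Matrix (Fin d) (Fin d) ℝ) (x x' : Fin d → ℝ) :
    edgeArm x x' ⬝ᵥ M.vec = meanReward M x x' := by
  simp only [edgeArm, meanReward, dotProduct, Matrix.mulVec, Matrix.vec, Matrix.vecMulVec_apply,
    Fintype.sum_prod_type, Finset.mul_sum]
  rw [Finset.sum_comm]
  refine Finset.sum_congr rfl fun i _ => Finset.sum_congr rfl fun j _ => ?_
  ring

/-! ### The greedy cut -/

section Graph

variable {V : Type*} [Fintype V] [DecidableEq V] (G : SimpleGraph V) [DecidableRel G.Adj]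

/-- One step of the greedy cut: the node `i` joins `V₂` if it has strictly more neighbours in
`V₁` than in `V₂`, and joins `V₁` otherwise. -/
def cutStep (P : Finset V × Finset V) (i : V) : Finset V × Finset V :=
  if (P.2.filter fun j => G.Adj i j).card < (P.1.filter fun j => G.Adj i j).card then
    (P.1, insert i P.2)
  else
    (insert i P.1, P.2)

/-- The greedy approximation of max-cut: the nodes are treated one after the other in the given
order, starting from `V₁ = V₂ = ∅`. -/
def approxMaxCut (order : List V) : Finset V × Finset V :=
  order.foldl (cutStep G) (∅, ∅)

/-- The allocation of a pair of node-arms along a cut: `x` on `V₁` and `x'` on the other nodes. -/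
def allocate {d : ℕ} (P : Finset V × Finset V) (x x' : Fin d → ℝ) (i : V) : Fin d → ℝ :=
  if i ∈ P.1 then x else x'

/-! ### The optimal joint arm, the parameter `γ` and the `α`-regret

The directed edges `(i, j) ∈ E` are the darts of the simple graph `G`: each undirected edge gives
the two directed edges `(i, j)` and `(j, i)`, and there are no loops. -/

/-- The number `m` of directed edges. -/
def numEdges : ℕ := Fintype.card G.Dart

/-- The expected global reward of a joint arm: the sum of `x⁽ⁱ⁾ᵀ M x⁽ʲ⁾` over the directed
edges. -/
def globalReward {d : ℕ} (M : Matrix (Fin d) (Fin d) ℝ) (a : V → Fin d → ℝ) : ℝ :=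
  ∑ e : G.Dart, meanReward M (a e.fst) (a e.snd)

/-- `a` is an optimal joint arm. -/
def IsOptimalJointArm {d : ℕ} (X : Finset (Fin d → ℝ)) (M : Matrix (Fin d) (Fin d) ℝ)
    (a : V → Fin d → ℝ) : Prop :=
  (∀ i, a i ∈ X) ∧
    ∀ b : V → Fin d → ℝ, (∀ i, b i ∈ X) → globalReward G M b ≤ globalReward G M a

/-- The parameter `γ`: the minimum over the node-arms `x` of `⟨z_{xx}, θ⋆⟩`, divided by the average
over the directed edges of the optimal expected reward. -/
noncomputable def gammaParam {d : ℕ} (X : Finset (Fin d → ℝ)) (hX : X.Nonempty)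
    (M : Matrix (Fin d) (Fin d) ℝ) (xstar : V → Fin d → ℝ) : ℝ :=
  X.inf' hX fun x => (edgeArm x x ⬝ᵥ M.vec) / ((1 / (numEdges G : ℝ)) * globalReward G M xstar)

/-- The `α`-pseudo-regret over the rounds `1, …, T` when the joint arm `a t` is played at
round `t`. -/
def alphaRegret {d : ℕ} (M : Matrix (Fin d) (Fin d) ℝ) (xstar : V → Fin d → ℝ) (α : ℝ)
    (a : ℕ → V → Fin d → ℝ) (T : ℕ) : ℝ :=
  ∑ t ∈ Finset.Icc 1 T, ∑ e : G.Dart,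
    (α * meanReward M (xstar e.fst) (xstar e.snd) - meanReward M (a t e.fst) (a t e.snd))

end Graph

/-! ### Regularized least squares and confidence sets

`E` is the set of directed edges, `z s e` and `y s e` are the edge-arm and the reward of the edge
`e` at round `s`. -/

section Estimation

variable {E : Type*} [Fintype E] {d : ℕ}

/-- `A_t = λ I + ∑_{s ≤ t} ∑_e z zᵀ`. -/
noncomputable def gram (lam : ℝ) (z : ℕ → E → Fin d × Fin d → ℝ) (t : ℕ) :
    Matrix (Fin d × Fin d) (Fin d × Fin d) ℝ :=
  lam • (1 : Matrix (Fin d × Fin d) (Fin d × Fin d) ℝ) +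
    ∑ s ∈ Finset.Icc 1 t, ∑ e, Matrix.vecMulVec (z s e) (z s e)

/-- `b_t = ∑_{s ≤ t} ∑_e y z`. -/
noncomputable def response (z : ℕ → E → Fin d × Fin d → ℝ) (y : ℕ → E → ℝ) (t : ℕ) :
    Fin d × Fin d → ℝ :=
  ∑ s ∈ Finset.Icc 1 t, ∑ e, y s e • z s e

/-- The estimator `A_t⁻¹ b_t`. -/
noncomputable def estimator (lam : ℝ) (z : ℕ → E → Fin d × Fin d → ℝ) (y : ℕ → E → ℝ) (t : ℕ) :
    Fin d × Fin d → ℝ :=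
  (gram lam z t)⁻¹ *ᵥ response z y t

/-- The radius `σ √(d² log ((1 + t m L² / λ) / δ)) + √λ S`. -/
noncomputable def confRadius (d m : ℕ) (σ S L lam δ : ℝ) (t : ℕ) : ℝ :=
  σ * √((d : ℝ) ^ 2 * Real.log ((1 + t * m * L ^ 2 / lam) / δ)) + √lam * S

/-- The confidence set `C_t(δ)`, an ellipsoid around the estimator. -/
def confSet (σ S L lam δ : ℝ) (z : ℕ → E → Fin d × Fin d → ℝ) (y : ℕ → E → ℝ) (t : ℕ) :
    Set (Fin d × Fin d → ℝ) :=
  {θ | weightedNorm (gram lam z t) (θ - estimator lam z y t) ≤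
    confRadius d (Fintype.card E) σ S L lam δ t}

end Estimation

/-! ### The algorithm -/

/-- `(x, x')` is the pair of node-arms of a maximizer of `⟨z_{u u'} + z_{u' u}, θ⟩` over
`(u, u', θ) ∈ X² × C`. Ties may be broken in any way. -/
def IsOptimisticPair {d : ℕ} (X : Finset (Fin d → ℝ)) (C : Set (Fin d × Fin d → ℝ))
    (x x' : Fin d → ℝ) : Prop :=
  x ∈ X ∧ x' ∈ X ∧ ∃ θ ∈ C, ∀ u ∈ X, ∀ u' ∈ X, ∀ θ' ∈ C,
    (edgeArm u u' + edgeArm u' u) ⬝ᵥ θ' ≤ (edgeArm x x' + edgeArm x' x) ⬝ᵥ θ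

section Algorithm

variable {V : Type*} [Fintype V] [DecidableEq V] (G : SimpleGraph V) [DecidableRel G.Adj] {d : ℕ}

/-- The edge-arm of the directed edge `e` at round `s`, when the pair `(x s, x' s)` is allocated
along the cut `P`. -/
def playedArm (P : Finset V × Finset V) (x x' : ℕ → Fin d → ℝ) (s : ℕ) (e : G.Dart) :
    Fin d × Fin d → ℝ :=
  edgeArm (allocate P (x s) (x' s) e.fst) (allocate P (x s) (x' s) e.snd)

/-- The noisy reward of the directed edge `e` at round `s`. -/
def observedReward (M : Matrix (Fin d) (Fin d) ℝ) (P : Finset V × Finset V)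
    (η : ℕ → G.Dart → ℝ) (x x' : ℕ → Fin d → ℝ) (s : ℕ) (e : G.Dart) : ℝ :=
  meanReward M (allocate P (x s) (x' s) e.fst) (allocate P (x s) (x' s) e.snd) + η s e

/-- The pairs `(x t, x' t)`, `1 ≤ t ≤ T`, are those of a run of the algorithm over `T` rounds, with
the cut returned by the greedy procedure, for the noise values `η`: the pair of round `t + 1` is
optimistic for the confidence set computed from the first `t` rounds. -/
def IsRun (order : List V) (X : Finset (Fin d → ℝ)) (M : Matrix (Fin d) (Fin d) ℝ)
    (σ S L lam δ : ℝ) (T : ℕ) (η : ℕ → G.Dart → ℝ) (x x' : ℕ → Fin d → ℝ) : Prop :=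
  ∀ t < T, IsOptimisticPair X
    (confSet σ S L lam δ (playedArm G (approxMaxCut G order) x x')
      (observedReward G M (approxMaxCut G order) η x x') t)
    (x (t + 1)) (x' (t + 1))

end Algorithm

/-! ### The noise -/

/-- The noise of the rounds `1, …, T` is conditionally `σ`-sub-Gaussian: `ℱ t` is the information
available at the end of round `t`, the noise vector `(η (t + 1) e)_e` is revealed at round `t + 1`,
and given `ℱ t` it is a sub-Gaussian vector with variance proxy `σ² I`. This holds, for example,
if the noise variables are independent over rounds and edges, each one is `σ`-sub-Gaussian with
mean zero, and `ℱ` is their natural filtration; it forces conditional mean zero. -/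
structure IsSubgaussianNoise {Ω E : Type*} [Fintype E] [mΩ : MeasurableSpace Ω] (μ : Measure Ω)
    (ℱ : Filtration ℕ mΩ) (σ : ℝ) (T : ℕ) (η : ℕ → E → Ω → ℝ) : Prop where
  adapted : ∀ t < T, ∀ e, Measurable[ℱ (t + 1)] (η (t + 1) e)
  integrable : ∀ t < T, ∀ c : E → ℝ,
    Integrable (fun ω => Real.exp (∑ e, c e * η (t + 1) e ω)) μ
  condExp_le : ∀ t < T, ∀ c : E → ℝ,
    μ[fun ω => Real.exp (∑ e, c e * η (t + 1) e ω) | ℱ t] ≤ᵐ[μ]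
      fun _ => Real.exp (σ ^ 2 * (∑ e, c e ^ 2) / 2)

/-! ### The bound -/

/-- The regret bound, with `m` directed edges, dimension `d` and horizon `T`. -/
noncomputable def regretBound (d m T : ℕ) (σ S L lam δ : ℝ) : ℝ :=
  √(32 * T * m * (d : ℝ) ^ 2 * max 2 ((L * S) ^ 2) *
      Real.log (1 + (T * m * L ^ 2 / lam) / (d : ℝ) ^ 2)) *
    (σ * √((d : ℝ) ^ 2 * Real.log ((1 + T * m * L ^ 2 / lam) / δ)) + √lam * S) +
  L * S * m * ((max 0 ⌈(d : ℝ) ^ 2 * Real.logb 2 ((T * m * L ^ 2 / lam) / δ)⌉ : ℤ) : ℝ)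

end GraphicalBilinearBandit

/-! One round. Let `c` be the number of cut directed edges; the greedy cut gives `c ≥ m / 2`. Let
`o` be the average optimal reward of an edge and `B` the optimistic value of the chosen pair. When
`θ⋆` lies in the confidence set, `B` dominates `⟨z_{vv'} + z_{v'v}, θ⋆⟩` for all `v, v'`; averaging
over the directed edges, each paired with its reversal, gives `B ≥ 2 o`. The two ends of an uncut
edge play the same arm, so that edge earns at least `γ o`. Comparing with `α m o` leaves only `γ (c
- m / 2) ≤ c - m / 2`, and the `α`-regret of the round is at most the sum of `⟨z, θ̃ - θ⋆⟩` over the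
cut edges (`round_regret_le`).

Concentration. For fixed `v`, `exp (⟨v, ∑ η z⟩ / σ - ‖v‖²_{A_t} / 2)` is a nonnegative
supermartingale. Its integral over `v`, in which `λ I` acts as a Gaussian prior, has a closed form
in `‖∑ η z‖_{A_t⁻¹}` and `det A_t`. Ville's inequality then bounds the noise uniformly in `t`
(`measure_noise_bound`), which puts `θ⋆` in every confidence set with probability at least `1 - δ`.

Summation. With `W` the sum of `‖z‖²_{A⁻¹}` over the edges of a round, `A` being the Gram matrix
before that round, Cauchy–Schwarz bounds the regret of the round by `2 β √m √W`. Moreover `log (1 +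
W)` is at most the growth of `log det A`, whose total is at most `d² log (1 + u / d²)` with `u = T m
L² / λ`. Rounds with `W ≤ 1` are summed by Cauchy–Schwarz and give the first term. Each round with
`W > 1` raises `log det A` by at least `log 2`, so there are few of them; each costs at most `L S
m`, which gives the second term (`sum_le_sqrt_growth_add`, `natCast_le_max_ceil`). -/

namespace GraphicalBilinearBandit

/-! ### Weighted norms, determinant inequalities and Gaussian integrals -/

section LinearAlgebra

variable {ι : Type*} [Fintype ι]

theorem euclNorm_eq_sqrt (v : ι → ℝ) : euclNorm v = √(v ⬝ᵥ v) := by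
  simp [euclNorm, EuclideanSpace.norm_eq, dotProduct, pow_two]

theorem euclNorm_nonneg (v : ι → ℝ) : 0 ≤ euclNorm v := norm_nonneg _

theorem euclNorm_sq (v : ι → ℝ) : euclNorm v ^ 2 = v ⬝ᵥ v := by
  rw [euclNorm_eq_sqrt, Real.sq_sqrt]
  exact Finset.sum_nonneg fun i _ => mul_self_nonneg _

theorem euclNorm_add_le (v w : ι → ℝ) : euclNorm (v + w) ≤ euclNorm v + euclNorm w := by
  simpa [euclNorm] using norm_add_le (WithLp.toLp 2 v) (WithLp.toLp 2 w)

theorem dotProduct_le_euclNorm_mul (v w : ι → ℝ) : v ⬝ᵥ w ≤ euclNorm v * euclNorm w := by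
  simpa [euclNorm_eq_sqrt, dotProduct, pow_two] using
    Real.sum_mul_le_sqrt_mul_sqrt Finset.univ v w

theorem dotProduct_transpose_mul_mulVec {κ : Type*} [Fintype κ] (B : Matrix κ ι ℝ) (v w : ι → ℝ) :
    v ⬝ᵥ (Bᵀ * B) *ᵥ w = (B *ᵥ v) ⬝ᵥ (B *ᵥ w) := by
  rw [← Matrix.mulVec_mulVec, Matrix.dotProduct_mulVec, Matrix.vecMul_transpose]

theorem weightedNorm_transpose_mul_self {κ : Type*} [Fintype κ] (B : Matrix κ ι ℝ) (v : ι → ℝ) :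
    weightedNorm (Bᵀ * B) v = euclNorm (B *ᵥ v) := by
  rw [weightedNorm, dotProduct_transpose_mul_mulVec, euclNorm_eq_sqrt]

theorem weightedNorm_nonneg (A : Matrix ι ι ℝ) (v : ι → ℝ) : 0 ≤ weightedNorm A v :=
  Real.sqrt_nonneg _

theorem weightedNorm_sub_comm (A : Matrix ι ι ℝ) (v w : ι → ℝ) :
    weightedNorm A (v - w) = weightedNorm A (w - v) := by
  rw [← neg_sub, weightedNorm, weightedNorm, Matrix.mulVec_neg, neg_dotProduct_neg]

theorem weightedNorm_sq {A : Matrix ι ι ℝ} (hA : A.PosSemidef) (v : ι → ℝ) :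
    weightedNorm A v ^ 2 = v ⬝ᵥ A *ᵥ v :=
  Real.sq_sqrt (by simpa using hA.dotProduct_mulVec_nonneg v)

/-- The Gaussian integral `∫ exp (-|w|² / 2) dw`. -/
noncomputable def gaussConst (ι : Type*) [Fintype ι] : ENNReal :=
  ∫⁻ w : ι → ℝ, ENNReal.ofReal (Real.exp (-(w ⬝ᵥ w) / 2))

/-- The value of the Gaussian constant is irrelevant: it cancels when two mixtures are compared,
which only requires it to be nonzero and finite. -/
theorem gaussConst_ne_zero : gaussConst ι ≠ 0 := by
  have hm : Measurable fun w : ι → ℝ => ENNReal.ofReal (Real.exp (-(w ⬝ᵥ w) / 2)) := by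
    unfold dotProduct; fun_prop
  rw [gaussConst, Ne, lintegral_eq_zero_iff hm]
  intro h
  have h2 : ∀ᵐ _ : ι → ℝ, False := by
    filter_upwards [h] with w hw
    exact (ENNReal.ofReal_pos.mpr (Real.exp_pos _)).ne' hw
  exact (NeZero.ne (volume : Measure (ι → ℝ))) (by simpa using h2)

theorem gaussConst_ne_top : gaussConst ι ≠ ⊤ := by
  have h1 : Integrable fun x : ℝ => Real.exp (-(1 / 2) * x ^ 2) :=
    integrable_exp_neg_mul_sq (by norm_num)
  have h2 : Integrable (fun w : ι → ℝ => ∏ i, Real.exp (-(1 / 2) * w i ^ 2)) :=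
    Integrable.fintype_prod (μ := fun _ : ι => (volume : Measure ℝ)) fun _ => h1
  have h3 : (fun w : ι → ℝ => ∏ i, Real.exp (-(1 / 2) * w i ^ 2)) =
      fun w => Real.exp (-(w ⬝ᵥ w) / 2) := by
    ext w
    rw [← Real.exp_sum, dotProduct, ← Finset.mul_sum]
    congr 1
    simp only [pow_two]; ring
  rw [h3] at h2
  exact h2.lintegral_lt_top.ne

variable [DecidableEq ι]

/-- Such a factor makes the `A`-norm of `v` the Euclidean norm of `B v`, and the `A⁻¹`-norm that of
`B⁻ᵀ v`. The weighted triangle and Cauchy–Schwarz inequalities, the determinant step and the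
Gaussian change of variables all reduce to the Euclidean case this way. -/
theorem exists_transpose_mul_self_of_posDef {A : Matrix ι ι ℝ} (hA : A.PosDef) :
    ∃ B : Matrix ι ι ℝ, IsUnit B.det ∧ A = Bᵀ * B := by
  open scoped MatrixOrder in
  obtain ⟨B, hB⟩ := CStarAlgebra.nonneg_iff_eq_star_mul_self.mp hA.posSemidef.nonneg
  have hB' : A = Bᵀ * B := by simpa [Matrix.star_eq_conjTranspose] using hB
  refine ⟨B, ?_, hB'⟩
  have h := hA.det_pos
  rw [hB', Matrix.det_mul, Matrix.det_transpose] at h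
  exact isUnit_iff_ne_zero.mpr fun h0 => by simp [h0] at h

theorem inv_transpose_mul_self (B : Matrix ι ι ℝ) :
    (Bᵀ * B)⁻¹ = (B⁻¹ᵀ)ᵀ * B⁻¹ᵀ := by
  rw [Matrix.mul_inv_rev, Matrix.transpose_transpose, Matrix.transpose_nonsing_inv]

theorem weightedNorm_add_le {A : Matrix ι ι ℝ} (hA : A.PosDef) (v w : ι → ℝ) :
    weightedNorm A (v + w) ≤ weightedNorm A v + weightedNorm A w := by
  obtain ⟨B, -, rfl⟩ := exists_transpose_mul_self_of_posDef hA
  simpa [weightedNorm_transpose_mul_self, Matrix.mulVec_add] using euclNorm_add_le _ _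

theorem dotProduct_le_weightedNorm_mul {A : Matrix ι ι ℝ} (hA : A.PosDef) (v w : ι → ℝ) :
    v ⬝ᵥ w ≤ weightedNorm A⁻¹ v * weightedNorm A w := by
  obtain ⟨B, hB, rfl⟩ := exists_transpose_mul_self_of_posDef hA
  rw [inv_transpose_mul_self, weightedNorm_transpose_mul_self, weightedNorm_transpose_mul_self]
  refine le_trans (le_of_eq ?_) (dotProduct_le_euclNorm_mul _ _)
  rw [Matrix.mulVec_transpose, ← Matrix.dotProduct_mulVec, Matrix.mulVec_mulVec,
    Matrix.nonsing_inv_mul _ hB, Matrix.one_mulVec]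

theorem weightedNorm_inv_mulVec {A : Matrix ι ι ℝ} (hA : A.PosDef) (v : ι → ℝ) :
    weightedNorm A (A⁻¹ *ᵥ v) = weightedNorm A⁻¹ v := by
  rw [weightedNorm, weightedNorm, Matrix.mulVec_mulVec,
    Matrix.mul_nonsing_inv _ (isUnit_iff_ne_zero.mpr hA.det_pos.ne'), Matrix.one_mulVec,
    dotProduct_comm]

/-- With `w = A⁻¹ v`, the bound `A ≥ λ I` reads `λ |w|² ≤ ⟨v, w⟩`. Multiply `⟨v, w⟩² ≤ |v|² |w|²` by
`λ` and cancel one factor `⟨v, w⟩`. -/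
theorem dotProduct_inv_mulVec_le {lam : ℝ} (hlam : 0 < lam) {A P : Matrix ι ι ℝ}
    (hA : A.PosDef) (hP : P.PosSemidef) (hAP : A = lam • (1 : Matrix ι ι ℝ) + P) (v : ι → ℝ) :
    v ⬝ᵥ A⁻¹ *ᵥ v ≤ v ⬝ᵥ v / lam := by
  set w := A⁻¹ *ᵥ v with hw
  have hv : v = A *ᵥ w := by
    rw [hw, Matrix.mulVec_mulVec, Matrix.mul_nonsing_inv _ (isUnit_iff_ne_zero.mpr hA.det_pos.ne'),
      Matrix.one_mulVec]
  have h1 : lam * (w ⬝ᵥ w) ≤ v ⬝ᵥ w := by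
    have h2 : w ⬝ᵥ v = lam * (w ⬝ᵥ w) + w ⬝ᵥ P *ᵥ w := by
      conv_lhs => rw [hv, hAP]
      simp [Matrix.add_mulVec, Matrix.smul_mulVec, dotProduct_add]
    have h3 : 0 ≤ w ⬝ᵥ P *ᵥ w := by simpa using hP.dotProduct_mulVec_nonneg w
    rw [dotProduct_comm v w]; linarith
  have h0 : 0 ≤ v ⬝ᵥ w := by simpa using hA.inv.posSemidef.dotProduct_mulVec_nonneg v
  have hvv : 0 ≤ v ⬝ᵥ v := by rw [← euclNorm_sq]; positivity
  have hcs : (v ⬝ᵥ w) ^ 2 ≤ (v ⬝ᵥ v) * (w ⬝ᵥ w) := by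
    simpa [dotProduct, pow_two] using Finset.sum_mul_sq_le_sq_mul_sq Finset.univ v w
  rw [le_div_iff₀ hlam]
  rcases h0.eq_or_lt with h | h
  · rw [← h]; simpa using hvv
  · refine le_of_mul_le_mul_left ?_ h
    nlinarith

theorem one_add_sum_le_prod {κ : Type*} (s : Finset κ) (f : κ → ℝ) (hf : ∀ i ∈ s, 0 ≤ f i) :
    1 + ∑ i ∈ s, f i ≤ ∏ i ∈ s, (1 + f i) := by
  classical
  induction s using Finset.induction_on with
  | empty => simp
  | insert a s ha ih =>
    have ih := ih fun i hi => hf i (Finset.mem_insert_of_mem hi)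
    have h1 := hf a (Finset.mem_insert_self a s)
    have h2 : 0 ≤ ∑ i ∈ s, f i := Finset.sum_nonneg fun i hi => hf i (Finset.mem_insert_of_mem hi)
    rw [Finset.sum_insert ha, Finset.prod_insert ha]
    nlinarith

theorem one_add_trace_le_det_one_add {P : Matrix ι ι ℝ} (hP : P.PosSemidef) :
    1 + P.trace ≤ (1 + P).det := by
  have h1 : (1 + P).det = ∏ i, (1 + hP.1.eigenvalues i) := by
    -- Up to the sign `(-1) ^ n`, `det (1 + P)` is the characteristic polynomial of `P` at `-1`, so
    -- it factors over the eigenvalues of `P`.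
    have h := congrArg (Polynomial.eval (-1)) hP.1.charpoly_eq
    rw [Matrix.eval_charpoly, Polynomial.eval_prod] at h
    have h2 : Matrix.scalar ι (-1 : ℝ) - P = -(1 + P) := by
      rw [map_neg, map_one]; abel
    rw [h2, Matrix.det_neg] at h
    have h3 : ∏ i, Polynomial.eval (-1) (Polynomial.X - Polynomial.C (hP.1.eigenvalues i)) =
        (-1) ^ Fintype.card ι * ∏ i, (1 + hP.1.eigenvalues i) := by
      rw [← Finset.card_univ, ← Finset.prod_const, ← Finset.prod_mul_distrib]
      refine Finset.prod_congr rfl fun i _ => ?_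
      simp; ring
    exact mul_left_cancel₀ (pow_ne_zero _ (by norm_num)) (h.trans h3)
  rw [h1, hP.1.trace_eq_sum_eigenvalues]
  exact one_add_sum_le_prod _ _ fun i _ => hP.eigenvalues_nonneg i

/-- All edge-arms of a round enter the Gram matrix together, so the rank-one determinant identity is
replaced by an inequality: factor out `Bᵀ` and `B`, then use `det (1 + P) ≥ 1 + tr P`. -/
theorem det_mul_one_add_sum_le_det_add {E : Type*} [Fintype E] {A : Matrix ι ι ℝ} (hA : A.PosDef)
    (z : E → ι → ℝ) :
    A.det * (1 + ∑ e, z e ⬝ᵥ A⁻¹ *ᵥ z e) ≤ (A + ∑ e, Matrix.vecMulVec (z e) (z e)).det := by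
  obtain ⟨B, hB, rfl⟩ := exists_transpose_mul_self_of_posDef hA
  set w : E → ι → ℝ := fun e => B⁻¹ᵀ *ᵥ z e with hw
  have hz : ∀ e, z e = Bᵀ *ᵥ w e := fun e => by
    rw [hw, Matrix.mulVec_mulVec, ← Matrix.transpose_mul, Matrix.nonsing_inv_mul _ hB,
      Matrix.transpose_one, Matrix.one_mulVec]
  have hP : (∑ e, Matrix.vecMulVec (w e) (w e)).PosSemidef :=
    Matrix.posSemidef_sum _ fun e _ => by
      simpa using Matrix.posSemidef_vecMulVec_self_star (w e)
  have htr : (∑ e, Matrix.vecMulVec (w e) (w e)).trace =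
      ∑ e, z e ⬝ᵥ (Bᵀ * B)⁻¹ *ᵥ z e := by
    rw [Matrix.trace_sum]
    refine Finset.sum_congr rfl fun e _ => ?_
    rw [inv_transpose_mul_self, dotProduct_transpose_mul_mulVec, Matrix.trace_vecMulVec]
  have hmat : Bᵀ * B + ∑ e, Matrix.vecMulVec (z e) (z e) =
      Bᵀ * (1 + ∑ e, Matrix.vecMulVec (w e) (w e)) * B := by
    rw [mul_add, add_mul, mul_one, Finset.mul_sum, Finset.sum_mul]
    congr 1
    refine Finset.sum_congr rfl fun e _ => ?_
    rw [Matrix.mul_vecMulVec, Matrix.vecMulVec_mul, ← Matrix.mulVec_transpose, ← hz]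
  rw [hmat, Matrix.det_mul, Matrix.det_mul, Matrix.det_mul, Matrix.det_transpose, ← htr]
  nlinarith [one_add_trace_le_det_one_add hP, mul_self_nonneg B.det]

/-- The arithmetic-geometric mean inequality for the eigenvalues. -/
theorem det_le_trace_div_card_pow [Nonempty ι] {A : Matrix ι ι ℝ} (hA : A.PosSemidef) :
    A.det ≤ (A.trace / Fintype.card ι) ^ Fintype.card ι := by
  have hn : (0 : ℝ) < Fintype.card ι := by exact_mod_cast Fintype.card_pos
  have h := Real.geom_mean_le_arith_mean Finset.univ (fun _ : ι => (1 : ℝ)) hA.1.eigenvalues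
    (fun _ _ => zero_le_one) (by simpa using hn) fun i _ => hA.eigenvalues_nonneg i
  have h0 : 0 ≤ ∏ i, hA.1.eigenvalues i :=
    Finset.prod_nonneg fun i _ => hA.eigenvalues_nonneg i
  simp only [Real.rpow_one, Finset.sum_const, Finset.card_univ, nsmul_eq_mul, mul_one,
    one_mul] at h
  rw [hA.1.det_eq_prod_eigenvalues, hA.1.trace_eq_sum_eigenvalues]
  have h2 := pow_le_pow_left₀ (Real.rpow_nonneg h0 _) h (Fintype.card ι)
  rwa [Real.rpow_inv_natCast_pow h0 Fintype.card_ne_zero] at h2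

/-- Complete the square: with `A = Bᵀ B` and `r = B⁻ᵀ s`, the exponent is `|r|² / 2 - |B v - r|² /
2`. The substitution `w = B v - r` has Jacobian `|det B| = √(det A)`. -/
theorem lintegral_exp_quadratic {A : Matrix ι ι ℝ} (hA : A.PosDef) (s : ι → ℝ) :
    ∫⁻ v : ι → ℝ, ENNReal.ofReal (Real.exp (v ⬝ᵥ s - (v ⬝ᵥ A *ᵥ v) / 2)) =
      ENNReal.ofReal (Real.exp ((s ⬝ᵥ A⁻¹ *ᵥ s) / 2) / √A.det) * gaussConst ι := by
  obtain ⟨B, hB, hAB⟩ := exists_transpose_mul_self_of_posDef hA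
  have hdet : √A.det = |B.det| := by
    rw [hAB, Matrix.det_mul, Matrix.det_transpose, Real.sqrt_mul_self_eq_abs]
  have hB0 : B.det ≠ 0 := hB.ne_zero
  set f : (ι → ℝ) → ENNReal := fun w => ENNReal.ofReal (Real.exp (-(w ⬝ᵥ w) / 2)) with hf
  have hfm : Measurable f := by
    unfold f dotProduct; fun_prop
  have hs : s ⬝ᵥ A⁻¹ *ᵥ s = (B⁻¹ᵀ *ᵥ s) ⬝ᵥ (B⁻¹ᵀ *ᵥ s) := by
    rw [hAB, inv_transpose_mul_self, dotProduct_transpose_mul_mulVec]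
  set r := B⁻¹ᵀ *ᵥ s with hr
  have hsr : s = Bᵀ *ᵥ r := by
    rw [hr, Matrix.mulVec_mulVec, ← Matrix.transpose_mul, Matrix.nonsing_inv_mul _ hB,
      Matrix.transpose_one, Matrix.one_mulVec]
  have key : ∀ v : ι → ℝ, ENNReal.ofReal (Real.exp (v ⬝ᵥ s - (v ⬝ᵥ A *ᵥ v) / 2)) =
      ENNReal.ofReal (Real.exp ((s ⬝ᵥ A⁻¹ *ᵥ s) / 2)) * f (Matrix.toLin' B v - r) := by
    intro v
    rw [hf, ← ENNReal.ofReal_mul (Real.exp_pos _).le, ← Real.exp_add, hs, hAB,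
      dotProduct_transpose_mul_mulVec, Matrix.toLin'_apply]
    have h1 : v ⬝ᵥ s = (B *ᵥ v) ⬝ᵥ r := by
      rw [hsr, Matrix.dotProduct_mulVec, Matrix.vecMul_transpose]
    rw [h1]
    congr 2
    simp only [sub_dotProduct, dotProduct_sub, dotProduct_comm r (B *ᵥ v)]
    ring
  have hLm : Measurable (Matrix.toLin' B) :=
    (LinearMap.continuous_of_finiteDimensional _).measurable
  simp_rw [key]
  rw [lintegral_const_mul _ (show Measurable fun v => f (Matrix.toLin' B v - r) from
      hfm.comp (hLm.sub_const r)),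
    ← lintegral_map (f := fun w => f (w - r)) (hfm.comp (measurable_id.sub_const r)) hLm,
    Real.map_matrix_volume_pi_eq_smul_volume_pi hB0, lintegral_smul_measure,
    lintegral_sub_right_eq_self f r, hdet, div_eq_mul_inv (Real.exp _), ENNReal.ofReal_mul (Real.exp_pos _).le,
    abs_inv, smul_eq_mul, mul_assoc]
  rfl

end LinearAlgebra

/-! ### Recursion and determinant growth of the Gram matrix -/

section Gram

variable {E : Type*} [Fintype E] {d : ℕ}

theorem gram_zero (lam : ℝ) (z : ℕ → E → Fin d × Fin d → ℝ) :
    gram lam z 0 = lam • (1 : Matrix (Fin d × Fin d) (Fin d × Fin d) ℝ) := by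
  simp [gram]

theorem gram_succ (lam : ℝ) (z : ℕ → E → Fin d × Fin d → ℝ) (t : ℕ) :
    gram lam z (t + 1) = gram lam z t + ∑ e, Matrix.vecMulVec (z (t + 1) e) (z (t + 1) e) := by
  rw [gram, gram, Finset.sum_Icc_succ_top (by omega), add_assoc]

theorem response_zero (z : ℕ → E → Fin d × Fin d → ℝ) (y : ℕ → E → ℝ) : response z y 0 = 0 := by
  simp [response]

theorem response_succ (z : ℕ → E → Fin d × Fin d → ℝ) (y : ℕ → E → ℝ) (t : ℕ) :
    response z y (t + 1) = response z y t + ∑ e, y (t + 1) e • z (t + 1) e := by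
  rw [response, response, Finset.sum_Icc_succ_top (by omega)]

theorem posSemidef_sum_vecMulVec (z : ℕ → E → Fin d × Fin d → ℝ) (t : ℕ) :
    (∑ s ∈ Finset.Icc 1 t, ∑ e, Matrix.vecMulVec (z s e) (z s e)).PosSemidef :=
  Matrix.posSemidef_sum _ fun s _ => Matrix.posSemidef_sum _ fun e _ => by
    simpa using Matrix.posSemidef_vecMulVec_self_star (z s e)

theorem gram_posDef {lam : ℝ} (hlam : 0 < lam) (z : ℕ → E → Fin d × Fin d → ℝ) (t : ℕ) :
    (gram lam z t).PosDef :=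
  (Matrix.PosDef.one.smul hlam).add_posSemidef (posSemidef_sum_vecMulVec z t)

theorem det_gram_le {lam : ℝ} (hlam : 0 < lam) (hd : 0 < d) (z : ℕ → E → Fin d × Fin d → ℝ)
    (t : ℕ) {L : ℝ} (hz : ∀ s ∈ Finset.Icc 1 t, ∀ e, euclNorm (z s e) ≤ L) :
    (gram lam z t).det ≤
      lam ^ d ^ 2 * (1 + (t * Fintype.card E * L ^ 2 / lam) / (d : ℝ) ^ 2) ^ d ^ 2 := by
  have : Nonempty (Fin d) := ⟨⟨0, hd⟩⟩
  have hcard : Fintype.card (Fin d × Fin d) = d ^ 2 := by simp [pow_two]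
  have hD : (0 : ℝ) < (d : ℝ) ^ 2 := by positivity
  have htr : (gram lam z t).trace ≤ lam * (d : ℝ) ^ 2 + t * Fintype.card E * L ^ 2 := by
    rw [gram, Matrix.trace_add, Matrix.trace_smul, Matrix.trace_one, hcard, smul_eq_mul,
      Matrix.trace_sum]
    push_cast
    gcongr
    calc ∑ s ∈ Finset.Icc 1 t, (∑ e, Matrix.vecMulVec (z s e) (z s e)).trace
        ≤ ∑ s ∈ Finset.Icc 1 t, ∑ _e : E, L ^ 2 := by
          refine Finset.sum_le_sum fun s hs => ?_
          rw [Matrix.trace_sum]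
          refine Finset.sum_le_sum fun e _ => ?_
          rw [Matrix.trace_vecMulVec, ← euclNorm_sq]
          exact pow_le_pow_left₀ (euclNorm_nonneg _) (hz s hs e) 2
      _ = t * Fintype.card E * L ^ 2 := by simp [mul_assoc]
  refine (det_le_trace_div_card_pow (gram_posDef hlam z t).posSemidef).trans ?_
  rw [hcard, ← mul_pow]
  push_cast
  refine pow_le_pow_left₀ (div_nonneg (gram_posDef hlam z t).posSemidef.trace_nonneg hD.le) ?_ _
  rw [div_le_iff₀ hD]
  refine htr.trans (le_of_eq ?_)
  field_simp

theorem dotProduct_gram_mulVec_succ (lam : ℝ) (z : ℕ → E → Fin d × Fin d → ℝ) (t : ℕ)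
    (v : Fin d × Fin d → ℝ) :
    v ⬝ᵥ gram lam z (t + 1) *ᵥ v = v ⬝ᵥ gram lam z t *ᵥ v + ∑ e, (v ⬝ᵥ z (t + 1) e) ^ 2 := by
  rw [gram_succ, Matrix.add_mulVec, dotProduct_add, Matrix.sum_mulVec, dotProduct_sum]
  congr 1
  refine Finset.sum_congr rfl fun e _ => ?_
  rw [Matrix.vecMulVec_mulVec]
  simp [dotProduct_smul, dotProduct_comm, pow_two]

end Gram

/-! ### Ville's inequality and predictable sub-Gaussian increments -/

section Maximal

variable {Ω : Type*} {mΩ : MeasurableSpace Ω}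

/-- Ville's inequality for a nonnegative supermartingale, on a finite horizon. -/
theorem mul_measure_exists_le_lintegral {μ : Measure Ω} {ℱ : Filtration ℕ mΩ}
    {M : ℕ → Ω → ENNReal} {n : ℕ} (hM : ∀ t ≤ n, Measurable[ℱ t] (M t))
    (hstep : ∀ t < n, ∀ B, MeasurableSet[ℱ t] B → ∫⁻ ω in B, M (t + 1) ω ∂μ ≤ ∫⁻ ω in B, M t ω ∂μ)
    (a : ENNReal) :
    a * μ {ω | ∃ t ≤ n, a ≤ M t ω} ≤ ∫⁻ ω, M 0 ω ∂μ := by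
  have hU : ∀ t ≤ n, MeasurableSet[ℱ t] {ω | ∃ s ≤ t, a ≤ M s ω} := by
    intro t ht
    have : {ω | ∃ s ≤ t, a ≤ M s ω} = ⋃ s ∈ Set.Iic t, {ω | a ≤ M s ω} := by
      ext ω; simp
    rw [this]
    refine MeasurableSet.biUnion (Set.to_countable _) fun s hs => ?_
    exact ℱ.mono hs _ (@measurableSet_le _ _ _ _ _ (ℱ s) _ _ _ _ _ measurable_const
      (hM s (le_trans hs ht)))
  -- The left side is a lower bound for the mean of the process stopped at its first passage above
  -- `a`: the paths already stopped count for `a`, the others for `M t`. It is propagated by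
  -- applying the supermartingale step on the paths not yet stopped.
  have main : ∀ t ≤ n, a * μ {ω | ∃ s ≤ t, a ≤ M s ω} +
      ∫⁻ ω in {ω | ∃ s ≤ t, a ≤ M s ω}ᶜ, M t ω ∂μ ≤ ∫⁻ ω, M 0 ω ∂μ := by
    intro t
    induction t with
    | zero =>
      intro _
      have h0 : MeasurableSet {ω | ∃ s ≤ 0, a ≤ M s ω} := ℱ.le 0 _ (hU 0 (Nat.zero_le _))
      have h1 : a * μ {ω | ∃ s ≤ 0, a ≤ M s ω} ≤ ∫⁻ ω in {ω | ∃ s ≤ 0, a ≤ M s ω}, M 0 ω ∂μ := by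
        rw [← setLIntegral_const]
        refine setLIntegral_mono' h0 fun ω hω => ?_
        obtain ⟨s, hs, h⟩ := hω
        obtain rfl : s = 0 := by omega
        exact h
      exact (add_le_add_left h1 _).trans_eq (lintegral_add_compl (M 0) h0)
    | succ t ih =>
      intro ht
      refine le_trans ?_ (ih (by omega))
      set U := {ω | ∃ s ≤ t, a ≤ M s ω} with hUdef
      set U' := {ω | ∃ s ≤ t + 1, a ≤ M s ω} with hUdef'
      have hmU : MeasurableSet U := ℱ.le t _ (hU t (by omega))
      have hmU' : MeasurableSet U' := ℱ.le (t + 1) _ (hU (t + 1) ht)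
      have hsub : U ⊆ U' := fun ω ⟨s, hs, h⟩ => ⟨s, by omega, h⟩
      have h1 : μ U' = μ U + μ (U' \ U) := by
        rw [← measure_inter_add_sdiff U' hmU, Set.inter_eq_self_of_subset_right hsub]
      have h2 : ∫⁻ ω in Uᶜ, M (t + 1) ω ∂μ =
          ∫⁻ ω in U' \ U, M (t + 1) ω ∂μ + ∫⁻ ω in U'ᶜ, M (t + 1) ω ∂μ := by
        rw [← lintegral_inter_add_sdiff _ Uᶜ hmU']
        congr 3
        · ext ω; simp [and_comm]
        · ext ω; simp only [Set.mem_sdiff, Set.mem_compl_iff]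
          exact ⟨fun h => h.2, fun h => ⟨fun h' => h (hsub h'), h⟩⟩
      have h3 : a * μ (U' \ U) ≤ ∫⁻ ω in U' \ U, M (t + 1) ω ∂μ := by
        rw [← setLIntegral_const]
        refine setLIntegral_mono' (hmU'.diff hmU) fun ω hω => ?_
        obtain ⟨⟨s, hs, h⟩, hn⟩ := hω
        rcases Nat.lt_or_ge t s with h' | h'
        · obtain rfl : s = t + 1 := by omega
          exact h
        · exact absurd ⟨s, h', h⟩ hn
      have h4 := hstep t (by omega) Uᶜ (hU t (by omega)).compl
      calc a * μ U' + ∫⁻ ω in U'ᶜ, M (t + 1) ω ∂μ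
          = a * μ U + (a * μ (U' \ U) + ∫⁻ ω in U'ᶜ, M (t + 1) ω ∂μ) := by
            rw [h1, mul_add, add_assoc]
        _ ≤ a * μ U + ∫⁻ ω in Uᶜ, M (t + 1) ω ∂μ := by rw [h2]; gcongr
        _ ≤ _ := by gcongr
  exact le_trans le_self_add (main n le_rfl)

variable {E : Type*} [Fintype E]

/-- The conditional bound says that the measure with density `exp (h - C)`, restricted to the
σ-algebra `m`, is dominated by `μ`. Integrating an `m`-measurable `g` against both gives the claim,
with no integrability condition on `g`. -/
theorem lintegral_mul_exp_le_of_const {μ : Measure Ω} [IsProbabilityMeasure μ]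
    {m : MeasurableSpace Ω} (hm : m ≤ mΩ) {h : Ω → ℝ} (hh : Measurable[mΩ] h) {C : ℝ}
    (hint : Integrable (fun ω => Real.exp (h ω)) μ)
    (hcond : μ[fun ω => Real.exp (h ω) | m] ≤ᵐ[μ] fun _ => Real.exp C)
    {g : Ω → ENNReal} (hg : Measurable[m] g) :
    ∫⁻ ω, g ω * ENNReal.ofReal (Real.exp (h ω - C)) ∂μ ≤ ∫⁻ ω, g ω ∂μ := by
  have hexp : Measurable[mΩ] fun ω => ENNReal.ofReal (Real.exp (h ω - C)) := by fun_prop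
  have hle : (μ.withDensity fun ω => ENNReal.ofReal (Real.exp (h ω - C))).trim hm ≤ μ.trim hm := by
    refine Measure.le_iff.mpr fun s hs => ?_
    rw [trim_measurableSet_eq hm hs, trim_measurableSet_eq hm hs, withDensity_apply _ (hm s hs)]
    have hint' : Integrable (fun ω => Real.exp (h ω - C)) μ := by
      simpa only [Real.exp_sub] using hint.div_const (Real.exp C)
    rw [← ofReal_integral_eq_lintegral_ofReal hint'.integrableOn
      (ae_of_all _ fun ω => (Real.exp_pos _).le)]
    rw [ENNReal.ofReal_le_iff_le_toReal (measure_ne_top _ _)]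
    simp only [Real.exp_sub]
    rw [integral_div, div_le_iff₀ (Real.exp_pos _), ← setIntegral_condExp hm hint hs]
    have h1 : ∫ ω in s, (μ[fun ω => Real.exp (h ω) | m]) ω ∂μ ≤ ∫ _ω in s, Real.exp C ∂μ :=
      setIntegral_mono_ae integrable_condExp.integrableOn
        (integrable_const _).integrableOn hcond
    simpa [measureReal_def] using h1
  calc ∫⁻ ω, g ω * ENNReal.ofReal (Real.exp (h ω - C)) ∂μ
      = ∫⁻ ω, g ω ∂(μ.withDensity fun ω => ENNReal.ofReal (Real.exp (h ω - C))) := by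
        rw [lintegral_withDensity_eq_lintegral_mul _ hexp (hg.mono hm le_rfl)]
        simp [mul_comm]
    _ = ∫⁻ ω, g ω ∂((μ.withDensity fun ω => ENNReal.ofReal (Real.exp (h ω - C))).trim hm) :=
        (lintegral_trim hm hg).symm
    _ ≤ ∫⁻ ω, g ω ∂(μ.trim hm) := lintegral_mono' hle le_rfl
    _ = ∫⁻ ω, g ω ∂μ := lintegral_trim hm hg

/-- The sub-Gaussian hypothesis concerns deterministic coefficients. Predictable coefficients with
finitely many values are constant on finitely many level sets in `m`, and the deterministic case
applies to each of them. -/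
theorem lintegral_mul_exp_le {μ : Measure Ω} [IsProbabilityMeasure μ]
    {m : MeasurableSpace Ω} (hm : m ≤ mΩ) {σ : ℝ} {η : E → Ω → ℝ} (hη : ∀ e, Measurable[mΩ] (η e))
    (hint : ∀ c : E → ℝ, Integrable (fun ω => Real.exp (∑ e, c e * η e ω)) μ)
    (hcond : ∀ c : E → ℝ, μ[fun ω => Real.exp (∑ e, c e * η e ω) | m] ≤ᵐ[μ]
      fun _ => Real.exp (σ ^ 2 * (∑ e, c e ^ 2) / 2))
    {c : Ω → E → ℝ} (hc : Measurable[m] c) (hcfin : (Set.range c).Finite)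
    {g : Ω → ENNReal} (hg : Measurable[m] g) :
    ∫⁻ ω, g ω * ENNReal.ofReal
      (Real.exp (∑ e, c ω e * η e ω - σ ^ 2 * (∑ e, c ω e ^ 2) / 2)) ∂μ ≤ ∫⁻ ω, g ω ∂μ := by
  classical
  have hset : ∀ b, MeasurableSet[m] (c ⁻¹' {b}) := fun b => hc (measurableSet_singleton b)
  have hgi : ∀ b, Measurable[m] ((c ⁻¹' {b}).indicator g) := fun b => hg.indicator (hset b)
  have hsum : ∀ ω (F : Ω → ENNReal), F ω = ∑ b ∈ hcfin.toFinset, (c ⁻¹' {b}).indicator F ω := by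
    intro ω F
    rw [Finset.sum_eq_single (c ω)]
    · simp
    · intro b _ hb
      exact Set.indicator_of_notMem (fun h => hb (by simpa using Eq.symm h)) _
    · intro h
      simp at h
  have hme : ∀ b : E → ℝ, Measurable[mΩ] fun ω => ENNReal.ofReal
      (Real.exp (∑ e, b e * η e ω - σ ^ 2 * (∑ e, b e ^ 2) / 2)) := fun b => by fun_prop
  calc _ = ∫⁻ ω, ∑ b ∈ hcfin.toFinset, (c ⁻¹' {b}).indicator g ω * ENNReal.ofReal
        (Real.exp (∑ e, b e * η e ω - σ ^ 2 * (∑ e, b e ^ 2) / 2)) ∂μ := by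
        refine lintegral_congr fun ω => ?_
        rw [hsum ω (fun ω => g ω * ENNReal.ofReal
          (Real.exp (∑ e, c ω e * η e ω - σ ^ 2 * (∑ e, c ω e ^ 2) / 2)))]
        refine Finset.sum_congr rfl fun b _ => ?_
        by_cases h : ω ∈ c ⁻¹' {b}
        · have hb : c ω = b := by simpa using h
          rw [Set.indicator_of_mem h, Set.indicator_of_mem h, hb]
        · rw [Set.indicator_of_notMem h, Set.indicator_of_notMem h, zero_mul]
    _ = ∑ b ∈ hcfin.toFinset, ∫⁻ ω, (c ⁻¹' {b}).indicator g ω * ENNReal.ofReal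
        (Real.exp (∑ e, b e * η e ω - σ ^ 2 * (∑ e, b e ^ 2) / 2)) ∂μ :=
        lintegral_finsetSum _ fun b _ => ((hgi b).mono hm le_rfl).mul (hme b)
    _ ≤ ∑ b ∈ hcfin.toFinset, ∫⁻ ω, (c ⁻¹' {b}).indicator g ω ∂μ := by
        refine Finset.sum_le_sum fun b _ => ?_
        exact lintegral_mul_exp_le_of_const hm (by fun_prop) (hint b) (hcond b) (hgi b)
    _ = ∫⁻ ω, g ω ∂μ := by
        rw [← lintegral_finsetSum _ fun b _ => (hgi b).mono hm le_rfl]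
        exact lintegral_congr fun ω => (hsum ω g).symm

end Maximal

/-! ### The Gaussian mixture supermartingale -/

section Mixture

/-- The unnormalized density of a shifted Gaussian. -/
noncomputable def expQuadratic {ι : Type*} [Fintype ι] (s : ι → ℝ) (A : Matrix ι ι ℝ)
    (v : ι → ℝ) : ENNReal :=
  ENNReal.ofReal (Real.exp (v ⬝ᵥ s - (v ⬝ᵥ A *ᵥ v) / 2))

theorem measurable_expQuadratic {Ω ι : Type*} [Fintype ι] {m : MeasurableSpace Ω}
    {s : Ω → ι → ℝ} {A : Ω → Matrix ι ι ℝ} (hs : ∀ i, Measurable fun ω => s ω i)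
    (hA : ∀ i j, Measurable fun ω => A ω i j) :
    Measurable fun p : Ω × (ι → ℝ) => expQuadratic (s p.1) (A p.1) p.2 := by
  unfold expQuadratic Matrix.mulVec dotProduct
  have h1 : ∀ i, Measurable fun p : Ω × (ι → ℝ) => s p.1 i := fun i => (hs i).comp measurable_fst
  have h2 : ∀ i j, Measurable fun p : Ω × (ι → ℝ) => A p.1 i j :=
    fun i j => (hA i j).comp measurable_fst
  fun_prop

variable {E : Type*} [Fintype E] {d : ℕ}

theorem measurable_response {Ω : Type*} {m : MeasurableSpace Ω}
    {z : Ω → ℕ → E → Fin d × Fin d → ℝ} {η : ℕ → E → Ω → ℝ} {t : ℕ}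
    (hz : ∀ s ∈ Finset.Icc 1 t, ∀ e, Measurable fun ω => z ω s e)
    (hη : ∀ s ∈ Finset.Icc 1 t, ∀ e, Measurable (η s e)) (i : Fin d × Fin d) :
    Measurable fun ω => response (z ω) (fun s e => η s e ω) t i := by
  simp only [response, Finset.sum_apply, Pi.smul_apply, smul_eq_mul]
  exact Finset.measurable_sum _ fun s hs => Finset.measurable_sum _ fun e _ =>
    (hη s hs e).mul ((measurable_pi_apply i).comp (hz s hs e))

theorem measurable_gram {Ω : Type*} {m : MeasurableSpace Ω}
    {z : Ω → ℕ → E → Fin d × Fin d → ℝ} {t : ℕ} (lam : ℝ)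
    (hz : ∀ s ∈ Finset.Icc 1 t, ∀ e, Measurable fun ω => z ω s e) (i j : Fin d × Fin d) :
    Measurable fun ω => gram lam (z ω) t i j := by
  simp only [gram, Matrix.add_apply, Matrix.sum_apply, Matrix.vecMulVec_apply]
  exact measurable_const.add <| Finset.measurable_sum _ fun s hs => Finset.measurable_sum _
    fun e _ => ((measurable_pi_apply i).comp (hz s hs e)).mul
      ((measurable_pi_apply j).comp (hz s hs e))

theorem measurable_expQuadratic_gram {Ω : Type*} {m : MeasurableSpace Ω}
    {z : Ω → ℕ → E → Fin d × Fin d → ℝ} {η : ℕ → E → Ω → ℝ} {t : ℕ} (σ lam : ℝ)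
    (hz : ∀ s ∈ Finset.Icc 1 t, ∀ e, Measurable fun ω => z ω s e)
    (hη : ∀ s ∈ Finset.Icc 1 t, ∀ e, Measurable (η s e)) :
    Measurable fun p : Ω × (Fin d × Fin d → ℝ) =>
      expQuadratic (σ⁻¹ • response (z p.1) (fun s e => η s e p.1) t) (gram lam (z p.1) t) p.2 :=
  measurable_expQuadratic (s := fun ω => σ⁻¹ • response (z ω) (fun s e => η s e ω) t)
    (A := fun ω => gram lam (z ω) t)
    (fun i => by
      simpa only [Pi.smul_apply, smul_eq_mul] using (measurable_response hz hη i).const_mul σ⁻¹)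
    (measurable_gram lam hz)

/-- The Gaussian mixture of the exponential martingales of the noise. -/
noncomputable def mixture (σ lam : ℝ) (z : ℕ → E → Fin d × Fin d → ℝ) (y : ℕ → E → ℝ) (t : ℕ) :
    ENNReal :=
  ∫⁻ v : Fin d × Fin d → ℝ, expQuadratic (σ⁻¹ • response z y t) (gram lam z t) v

theorem mixture_eq {σ lam : ℝ} (hlam : 0 < lam) (z : ℕ → E → Fin d × Fin d → ℝ)
    (y : ℕ → E → ℝ) (t : ℕ) :
    mixture σ lam z y t = ENNReal.ofReal
      (Real.exp (σ⁻¹ ^ 2 * weightedNorm (gram lam z t)⁻¹ (response z y t) ^ 2 / 2) /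
        √(gram lam z t).det) * gaussConst (Fin d × Fin d) := by
  unfold mixture expQuadratic
  rw [lintegral_exp_quadratic (gram_posDef hlam z t),
    weightedNorm_sq (gram_posDef hlam z t).inv.posSemidef, Matrix.mulVec_smul, smul_dotProduct,
    dotProduct_smul, smul_eq_mul, smul_eq_mul, ← mul_assoc, ← pow_two]

/-- With coefficients `c_e = ⟨v, z_e⟩ / σ`, the sub-Gaussian compensator `σ² ∑ c_e² / 2` is exactly
half the increment of the quadratic form of the Gram matrix at `v`. This is why the response is
divided by `σ`. -/
theorem expQuadratic_gram_succ {σ : ℝ} (hσ : 0 < σ) (lam : ℝ) (z : ℕ → E → Fin d × Fin d → ℝ)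
    (y : ℕ → E → ℝ) (t : ℕ) (v : Fin d × Fin d → ℝ) :
    expQuadratic (σ⁻¹ • response z y (t + 1)) (gram lam z (t + 1)) v =
      expQuadratic (σ⁻¹ • response z y t) (gram lam z t) v * ENNReal.ofReal
        (Real.exp (∑ e, σ⁻¹ * (v ⬝ᵥ z (t + 1) e) * y (t + 1) e -
          σ ^ 2 * (∑ e, (σ⁻¹ * (v ⬝ᵥ z (t + 1) e)) ^ 2) / 2)) := by
  rw [expQuadratic, expQuadratic, ← ENNReal.ofReal_mul (Real.exp_pos _).le, ← Real.exp_add,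
    response_succ, dotProduct_gram_mulVec_succ]
  congr 2
  simp only [mul_pow, ← Finset.mul_sum, smul_add, dotProduct_add, dotProduct_smul,
    dotProduct_sum, smul_eq_mul]
  have h2 : σ ^ 2 * (σ⁻¹ ^ 2 * ∑ e, (v ⬝ᵥ z (t + 1) e) ^ 2) = ∑ e, (v ⬝ᵥ z (t + 1) e) ^ 2 := by
    field_simp
  have h3 : ∑ e, σ⁻¹ * (v ⬝ᵥ z (t + 1) e) * y (t + 1) e =
      σ⁻¹ * ∑ e, y (t + 1) e * (v ⬝ᵥ z (t + 1) e) := by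
    rw [Finset.mul_sum]
    exact Finset.sum_congr rfl fun e _ => by ring
  rw [h2, h3]
  ring

variable {Ω : Type*} {mΩ : MeasurableSpace Ω} {μ : Measure Ω} {ℱ : Filtration ℕ mΩ}

theorem measurable_mixture {m : MeasurableSpace Ω} {z : Ω → ℕ → E → Fin d × Fin d → ℝ}
    {η : ℕ → E → Ω → ℝ} {t : ℕ} (σ lam : ℝ)
    (hz : ∀ s ∈ Finset.Icc 1 t, ∀ e, Measurable fun ω => z ω s e)
    (hη : ∀ s ∈ Finset.Icc 1 t, ∀ e, Measurable (η s e)) :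
    Measurable fun ω => mixture σ lam (z ω) (fun s e => η s e ω) t :=
  (measurable_expQuadratic_gram σ lam hz hη).lintegral_prod_right' (ν := volume)

theorem measurable_expQuadratic_gram_left {m : MeasurableSpace Ω}
    {z : Ω → ℕ → E → Fin d × Fin d → ℝ}
    {η : ℕ → E → Ω → ℝ} {t : ℕ} (σ lam : ℝ)
    (hz : ∀ s ∈ Finset.Icc 1 t, ∀ e, Measurable fun ω => z ω s e)
    (hη : ∀ s ∈ Finset.Icc 1 t, ∀ e, Measurable (η s e)) (v : Fin d × Fin d → ℝ) :
    Measurable fun ω =>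
      expQuadratic (σ⁻¹ • response (z ω) (fun s e => η s e ω) t) (gram lam (z ω) t) v :=
  Measurable.of_uncurry_right (f := fun ω v =>
      expQuadratic (σ⁻¹ • response (z ω) (fun s e => η s e ω) t) (gram lam (z ω) t) v)
    (measurable_expQuadratic_gram σ lam hz hη)

/-- Tonelli's theorem exchanges the integrals over `ω` and `v`; for each fixed `v` the inequality is
the one-step bound with predictable coefficients `⟨v, z_e⟩ / σ`. -/
theorem setLIntegral_mixture_succ_le [IsProbabilityMeasure μ] {σ lam : ℝ} (hσ : 0 < σ) {T : ℕ}
    {η : ℕ → E → Ω → ℝ} (hη : IsSubgaussianNoise μ ℱ σ T η)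
    {z : Ω → ℕ → E → Fin d × Fin d → ℝ}
    (hz : ∀ t < T, ∀ e, Measurable[ℱ t] fun ω => z ω (t + 1) e)
    (hfin : ∀ t < T, (Set.range fun ω => z ω (t + 1)).Finite)
    {t : ℕ} (ht : t < T) {B : Set Ω} (hB : MeasurableSet[ℱ t] B) :
    ∫⁻ ω in B, mixture σ lam (z ω) (fun s e => η s e ω) (t + 1) ∂μ ≤
      ∫⁻ ω in B, mixture σ lam (z ω) (fun s e => η s e ω) t ∂μ := by
  have hz' : ∀ s ∈ Finset.Icc 1 (t + 1), ∀ e, Measurable[ℱ t] fun ω => z ω s e := by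
    intro s hs e
    obtain ⟨h1, h2⟩ := Finset.mem_Icc.mp hs
    obtain ⟨r, rfl⟩ : ∃ r, s = r + 1 := ⟨s - 1, by omega⟩
    exact (hz r (by omega) e).mono (ℱ.mono (by omega)) le_rfl
  have hη' : ∀ s ∈ Finset.Icc 1 (t + 1), ∀ e, Measurable[ℱ s] (η s e) := by
    intro s hs e
    obtain ⟨h1, h2⟩ := Finset.mem_Icc.mp hs
    obtain ⟨r, rfl⟩ : ∃ r, s = r + 1 := ⟨s - 1, by omega⟩
    exact hη.adapted r (by omega) e
  have hη'' : ∀ s ∈ Finset.Icc 1 (t + 1), ∀ e, Measurable (η s e) :=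
    fun s hs e => (hη' s hs e).mono (ℱ.le s) le_rfl
  have hzm : ∀ s ∈ Finset.Icc 1 (t + 1), ∀ e, Measurable fun ω => z ω s e :=
    fun s hs e => (hz' s hs e).mono (ℱ.le t) le_rfl
  have hsub : ∀ s ∈ Finset.Icc 1 t, s ∈ Finset.Icc 1 (t + 1) := fun s hs =>
    Finset.Icc_subset_Icc_right (Nat.le_succ t) hs
  have hBm : MeasurableSet B := ℱ.le t _ hB
  have hmeas1 := measurable_expQuadratic_gram (t := t + 1) σ lam hzm hη''
  have hmeas0 := measurable_expQuadratic_gram (t := t) σ lam (fun s hs => hzm s (hsub s hs))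
    (fun s hs => hη'' s (hsub s hs))
  unfold mixture
  rw [lintegral_lintegral_swap (f := fun ω v => expQuadratic
      (σ⁻¹ • response (z ω) (fun s e => η s e ω) (t + 1)) (gram lam (z ω) (t + 1)) v)
      hmeas1.aemeasurable,
    lintegral_lintegral_swap (f := fun ω v => expQuadratic
      (σ⁻¹ • response (z ω) (fun s e => η s e ω) t) (gram lam (z ω) t) v) hmeas0.aemeasurable]
  refine lintegral_mono fun v => ?_
  rw [← lintegral_indicator hBm, ← lintegral_indicator hBm]
  have hgm : Measurable[ℱ t] fun ω =>
      expQuadratic (σ⁻¹ • response (z ω) (fun s e => η s e ω) t) (gram lam (z ω) t) v :=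
    measurable_expQuadratic_gram_left σ lam (fun s hs => hz' s (hsub s hs))
      (fun s hs e => (hη' s (hsub s hs) e).mono (ℱ.mono (Finset.mem_Icc.mp hs).2) le_rfl) v
  have hc : Measurable[ℱ t] fun ω e => σ⁻¹ * (v ⬝ᵥ z ω (t + 1) e) := by
    refine @measurable_pi_lambda _ _ _ (ℱ t) _ _ fun e => ?_
    have h1 : Measurable fun w : Fin d × Fin d → ℝ => σ⁻¹ * (v ⬝ᵥ w) := by
      unfold dotProduct; fun_prop
    exact h1.comp (hz t ht e)
  have hcfin : (Set.range fun ω e => σ⁻¹ * (v ⬝ᵥ z ω (t + 1) e)).Finite := by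
    have : (fun ω e => σ⁻¹ * (v ⬝ᵥ z ω (t + 1) e)) =
        (fun (w : E → Fin d × Fin d → ℝ) e => σ⁻¹ * (v ⬝ᵥ w e)) ∘ fun ω => z ω (t + 1) := rfl
    rw [this, Set.range_comp]
    exact (hfin t ht).image _
  have h := lintegral_mul_exp_le (μ := μ) (ℱ.le t) (σ := σ)
    (fun e => hη'' (t + 1) (by simp) e) (hη.integrable t ht) (hη.condExp_le t ht) hc hcfin
    (hgm.indicator hB)
  refine le_trans (le_of_eq (lintegral_congr fun ω => ?_)) h
  by_cases hω : ω ∈ B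
  · rw [Set.indicator_of_mem hω, Set.indicator_of_mem hω, expQuadratic_gram_succ hσ]
  · rw [Set.indicator_of_notMem hω, Set.indicator_of_notMem hω, zero_mul]

end Mixture

/-! ### Self-normalized concentration and validity of the confidence sets -/

section Confidence

variable {E : Type*} [Fintype E] {d : ℕ}

/-- On the event where the mixture has not grown by the factor `1 / δ`, the noise is small in the
norm of the inverse Gram matrix. -/
theorem weightedNorm_response_le_of_mixture_lt {σ lam δ L : ℝ} (hσ : 0 < σ) (hlam : 0 < lam)
    (hδ : 0 < δ) (hδ1 : δ ≤ 1) (hd : 2 ≤ d) {z : ℕ → E → Fin d × Fin d → ℝ} {y : ℕ → E → ℝ} {t : ℕ}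
    (hz : ∀ s ∈ Finset.Icc 1 t, ∀ e, euclNorm (z s e) ≤ L)
    (h : mixture σ lam z y t < mixture σ lam z y 0 / ENNReal.ofReal δ) :
    weightedNorm (gram lam z t)⁻¹ (response z y t) ≤
      σ * √((d : ℝ) ^ 2 * Real.log ((1 + t * Fintype.card E * L ^ 2 / lam) / δ)) := by
  set D := d ^ 2 with hDdef
  set u : ℝ := t * Fintype.card E * L ^ 2 / lam with hu
  have hD4 : 4 ≤ D := by rw [hDdef]; nlinarith
  have hD4' : (4 : ℝ) ≤ (D : ℝ) := by exact_mod_cast hD4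
  have hDcast : (d : ℝ) ^ 2 = (D : ℝ) := by rw [hDdef]; push_cast; rfl
  have hu0 : 0 ≤ u := by positivity
  have hdet := det_gram_le hlam (by omega) z t hz
  rw [← hDdef, ← hu, hDcast] at hdet
  have hdet0 := (gram_posDef hlam z t).det_pos
  set q := weightedNorm (gram lam z t)⁻¹ (response z y t) with hq
  have hq0 : 0 ≤ q := weightedNorm_nonneg _ _
  have hlamD : 0 < lam ^ D := pow_pos hlam _
  have hg0 : (gram lam z 0).det = lam ^ D := by
    rw [gram_zero, Matrix.det_smul, Matrix.det_one, mul_one]; simp [hDdef, pow_two]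
  rw [mixture_eq hlam, mixture_eq hlam, response_zero, hg0] at h
  have hw0 : weightedNorm (gram lam z 0)⁻¹ (0 : Fin d × Fin d → ℝ) = 0 := by simp [weightedNorm]
  rw [hw0, ← hq, ENNReal.mul_div_right_comm, ENNReal.mul_lt_mul_iff_left gaussConst_ne_zero
    gaussConst_ne_top, ← ENNReal.ofReal_div_of_pos hδ, ENNReal.ofReal_lt_ofReal_iff (by positivity)]
    at h
  have hlog := Real.log_lt_log (by positivity) h
  rw [Real.log_div (Real.exp_pos _).ne' (by positivity), Real.log_exp,
    Real.log_div (by positivity) hδ.ne', Real.log_div (Real.exp_pos _).ne' (by positivity),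
    Real.log_exp, Real.log_sqrt hdet0.le, Real.log_sqrt hlamD.le] at hlog
  have hlogdet := Real.log_le_log hdet0 hdet
  have hpos : 0 < 1 + u / D := by positivity
  rw [Real.log_mul hlamD.ne' (by positivity), Real.log_pow (1 + u / D)] at hlogdet
  have hmono : Real.log (1 + u / D) ≤ Real.log (1 + u) := by
    refine Real.log_le_log hpos ?_
    have : u / D ≤ u := div_le_self hu0 (by linarith)
    linarith
  have hδlog : Real.log δ ≤ 0 := Real.log_nonpos hδ.le hδ1
  -- The logarithms give `q² / σ² < log (det A_t / λ ^ D) + 2 log (1 / δ)`. The determinant term is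
  -- at most `D log (1 + u)`, and the factor `2` is absorbed in `D ≥ 4`.
  have hfin : σ⁻¹ ^ 2 * q ^ 2 ≤ D * Real.log ((1 + u) / δ) := by
    rw [Real.log_div (by positivity) hδ.ne']
    nlinarith
  have : (σ⁻¹ * q) ≤ √(D * Real.log ((1 + u) / δ)) :=
    Real.le_sqrt_of_sq_le (by rw [mul_pow]; exact hfin)
  rw [hDcast]
  calc q = σ * (σ⁻¹ * q) := by field_simp
    _ ≤ _ := by gcongr

variable {Ω : Type*} {mΩ : MeasurableSpace Ω} {μ : Measure Ω} {ℱ : Filtration ℕ mΩ}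

/-- For `σ = 0`, both `exp η` and `exp (-η)` have mean at most `1`, so `cosh η` has mean at most
`1`; but `cosh ≥ 1`, with equality only at `0`. -/
theorem noise_ae_eq_zero [IsProbabilityMeasure μ] {T : ℕ} {η : ℕ → E → Ω → ℝ}
    (hη : IsSubgaussianNoise μ ℱ 0 T η) {t : ℕ} (ht : t < T) (e : E) :
    ∀ᵐ ω ∂μ, η (t + 1) e ω = 0 := by
  classical
  have hexp : ∀ b : ℝ, Integrable (fun ω => Real.exp (b * η (t + 1) e ω)) μ ∧
      ∫ ω, Real.exp (b * η (t + 1) e ω) ∂μ ≤ 1 := by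
    intro b
    have h1 : ∀ ω, ∑ i, (Pi.single e b : E → ℝ) i * η (t + 1) i ω = b * η (t + 1) e ω := by
      intro ω
      rw [Finset.sum_eq_single e] <;> simp +contextual
    have hint := hη.integrable t ht (Pi.single e b)
    have hc := hη.condExp_le t ht (Pi.single e b)
    simp only [h1] at hint hc
    refine ⟨hint, ?_⟩
    rw [← integral_condExp (ℱ.le t)]
    refine (integral_mono_ae integrable_condExp (integrable_const _) hc).trans ?_
    simp
  obtain ⟨hi1, h1⟩ := hexp 1
  obtain ⟨hi2, h2⟩ := hexp (-1)
  have hcosh : ∀ ω, Real.exp (1 * η (t + 1) e ω) + Real.exp (-1 * η (t + 1) e ω) - 2 =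
      2 * (Real.cosh (η (t + 1) e ω) - 1) := fun ω => by
    rw [Real.cosh_eq]; ring_nf
  have hnn : 0 ≤ fun ω => Real.exp (1 * η (t + 1) e ω) + Real.exp (-1 * η (t + 1) e ω) - 2 :=
    fun ω => by
      simp only [hcosh, Pi.zero_apply]
      have := Real.one_le_cosh (η (t + 1) e ω)
      linarith
  have hi := (hi1.add hi2).sub (integrable_const (2 : ℝ))
  have hint0 : ∫ ω, (Real.exp (1 * η (t + 1) e ω) + Real.exp (-1 * η (t + 1) e ω) - 2) ∂μ = 0 := by
    refine le_antisymm ?_ (integral_nonneg hnn)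
    have h3 := (integral_sub (hi1.add hi2) (integrable_const (2 : ℝ))).trans
      (congrArg (· - ∫ _, (2 : ℝ) ∂μ) (integral_add hi1 hi2))
    simp only [integral_const, probReal_univ, one_smul, Pi.add_apply] at h3
    linarith
  filter_upwards [(integral_eq_zero_iff_of_nonneg hnn hi).mp hint0] with ω hω
  by_contra hne
  have h3 := Real.one_lt_cosh.mpr hne
  simp only [hcosh, Pi.zero_apply] at hω
  linarith

/-- The self-normalized concentration inequality for the noise, uniformly over the rounds. -/
theorem measure_noise_bound [IsProbabilityMeasure μ] {σ lam δ L : ℝ} (hσ : 0 ≤ σ) (hlam : 0 < lam)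
    (hδ : 0 < δ) (hδ1 : δ ≤ 1) (hd : 2 ≤ d) {T : ℕ}
    {η : ℕ → E → Ω → ℝ} (hη : IsSubgaussianNoise μ ℱ σ T η)
    {z : Ω → ℕ → E → Fin d × Fin d → ℝ}
    (hz : ∀ t < T, ∀ e, Measurable[ℱ t] fun ω => z ω (t + 1) e)
    (hfin : ∀ t < T, (Set.range fun ω => z ω (t + 1)).Finite)
    (hL : ∀ ω, ∀ t < T, ∀ e, euclNorm (z ω (t + 1) e) ≤ L) :
    ENNReal.ofReal (1 - δ) ≤ μ {ω | ∀ t ≤ T,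
      weightedNorm (gram lam (z ω) t)⁻¹ (response (z ω) (fun s e => η s e ω) t) ≤
      σ * √((d : ℝ) ^ 2 * Real.log ((1 + t * Fintype.card E * L ^ 2 / lam) / δ))} := by
  -- The mixture is scaled by `σ⁻¹`, so `σ = 0` is treated apart: the noise then vanishes almost
  -- surely.
  rcases hσ.eq_or_lt with rfl | hσ
  · have hae : ∀ᵐ ω ∂μ, ∀ s ∈ Finset.Icc 1 T, ∀ e, η s e ω = 0 := by
      rw [Filter.eventually_all_finset]
      intro s hs
      rw [ae_all_iff]
      intro e
      obtain ⟨h1, h2⟩ := Finset.mem_Icc.mp hs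
      obtain ⟨r, rfl⟩ : ∃ r, s = r + 1 := ⟨s - 1, by omega⟩
      exact noise_ae_eq_zero hη (by omega) e
    have hall : ∀ᵐ ω ∂μ, ω ∈ {ω | ∀ t ≤ T,
        weightedNorm (gram lam (z ω) t)⁻¹ (response (z ω) (fun s e => η s e ω) t) ≤
        0 * √((d : ℝ) ^ 2 * Real.log ((1 + t * Fintype.card E * L ^ 2 / lam) / δ))} := by
      filter_upwards [hae] with ω hω t ht
      have : response (z ω) (fun s e => η s e ω) t = 0 := by
        refine Finset.sum_eq_zero fun s hs => Finset.sum_eq_zero fun e _ => ?_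
        simp only [hω s (Finset.Icc_subset_Icc_right ht hs) e, zero_smul]
      rw [this]
      simp [weightedNorm]
    refine (ENNReal.ofReal_le_one.mpr (by linarith)).trans ?_
    rw [← measure_univ (μ := μ)]
    exact measure_mono_ae (hall.mono fun ω hω _ => hω)
  · set M : ℕ → Ω → ENNReal := fun t ω => mixture σ lam (z ω) (fun s e => η s e ω) t with hM
    have hmeas : ∀ t ≤ T, Measurable[ℱ t] (M t) := by
      intro t ht
      refine @measurable_mixture E _ d Ω (ℱ t) z η t σ lam (fun s hs e => ?_) fun s hs e => ?_ <;>
      · obtain ⟨h1, h2⟩ := Finset.mem_Icc.mp hs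
        obtain ⟨r, rfl⟩ : ∃ r, s = r + 1 := ⟨s - 1, by omega⟩
        first
          | exact (hz r (by omega) e).mono (ℱ.mono (by omega)) le_rfl
          | exact (hη.adapted r (by omega) e).mono (ℱ.mono (by omega)) le_rfl
    -- Before the first round the response is `0` and the Gram matrix is `λ I`, so the initial
    -- mixture is deterministic and cancels in Ville's inequality at level `M0 / δ`.
    obtain ⟨M0, hM0, hM0z, hM0t⟩ : ∃ M0 : ENNReal, (∀ ω, M 0 ω = M0) ∧ M0 ≠ 0 ∧ M0 ≠ ⊤ := by
      have hdet : 0 < (lam • (1 : Matrix (Fin d × Fin d) (Fin d × Fin d) ℝ)).det :=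
        (Matrix.PosDef.one.smul hlam).det_pos
      refine ⟨ENNReal.ofReal (Real.exp 0 /
          √(lam • (1 : Matrix (Fin d × Fin d) (Fin d × Fin d) ℝ)).det) *
          gaussConst (Fin d × Fin d), fun ω => ?_, ?_, ?_⟩
      · simp only [hM, mixture_eq hlam, response_zero, gram_zero]
        simp [weightedNorm]
      · refine mul_ne_zero (ENNReal.ofReal_pos.mpr (by positivity)).ne' gaussConst_ne_zero
      · exact ENNReal.mul_ne_top ENNReal.ofReal_ne_top gaussConst_ne_top
    set U := {ω | ∃ t ≤ T, M0 / ENNReal.ofReal δ ≤ M t ω} with hU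
    have hville := mul_measure_exists_le_lintegral (μ := μ) hmeas
      (fun t ht B hB => setLIntegral_mixture_succ_le hσ hη hz hfin ht hB) (M0 / ENNReal.ofReal δ)
    simp only [hM0, lintegral_const, measure_univ, mul_one] at hville
    have hδ' : ENNReal.ofReal δ ≠ 0 := (ENNReal.ofReal_pos.mpr hδ).ne'
    have hμU : μ U ≤ ENNReal.ofReal δ := by
      have h1 : M0 * (μ U / ENNReal.ofReal δ) ≤ M0 * 1 := by
        rw [mul_one, ← mul_div_assoc, ENNReal.mul_div_right_comm]; exact hville
      have h2 := (ENNReal.mul_le_mul_iff_right hM0z hM0t).mp h1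
      rwa [ENNReal.div_le_iff hδ' ENNReal.ofReal_ne_top, one_mul] at h2
    have hUm : MeasurableSet U := by
      have : U = ⋃ t ∈ Set.Iic T, {ω | M0 / ENNReal.ofReal δ ≤ M t ω} := by
        ext ω; simp [hU]
      rw [this]
      exact MeasurableSet.biUnion (Set.to_countable _) fun t ht =>
        measurableSet_le measurable_const ((hmeas t ht).mono (ℱ.le t) le_rfl)
    calc ENNReal.ofReal (1 - δ) = 1 - ENNReal.ofReal δ := by
          rw [ENNReal.ofReal_sub _ hδ.le, ENNReal.ofReal_one]
      _ ≤ 1 - μ U := tsub_le_tsub_left hμU 1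
      _ = μ Uᶜ := (prob_compl_eq_one_sub hUm).symm
      _ ≤ _ := by
        refine measure_mono fun ω hω t ht => ?_
        refine weightedNorm_response_le_of_mixture_lt hσ hlam hδ hδ1 hd (fun s hs e => ?_) ?_
        · obtain ⟨h1, h2⟩ := Finset.mem_Icc.mp hs
          obtain ⟨r, rfl⟩ : ∃ r, s = r + 1 := ⟨s - 1, by omega⟩
          exact hL ω r (by omega) e
        · rw [show mixture σ lam (z ω) (fun s e => η s e ω) 0 = M0 from hM0 ω]
          exact not_le.mp fun hle => hω ⟨t, ht, hle⟩

/-- The response equals `(A_t - λ I) θ` plus the noise response. Hence the error splits into a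
regularization bias `λ θ` and a noise part, both seen through `A_t⁻¹`. -/
theorem estimator_sub_eq {lam : ℝ} (hlam : 0 < lam) (z : ℕ → E → Fin d × Fin d → ℝ)
    (y η : ℕ → E → ℝ) (θ : Fin d × Fin d → ℝ) (t : ℕ)
    (hy : ∀ s ∈ Finset.Icc 1 t, ∀ e, y s e = z s e ⬝ᵥ θ + η s e) :
    θ - estimator lam z y t =
      (gram lam z t)⁻¹ *ᵥ (lam • θ + -response z η t) := by
  have hresp : response z y t = gram lam z t *ᵥ θ - lam • θ + response z η t := by
    rw [gram, Matrix.add_mulVec, Matrix.smul_mulVec, Matrix.one_mulVec, add_sub_cancel_left,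
      Matrix.sum_mulVec, response, response, ← Finset.sum_add_distrib]
    refine Finset.sum_congr rfl fun s hs => ?_
    rw [Matrix.sum_mulVec, ← Finset.sum_add_distrib]
    refine Finset.sum_congr rfl fun e _ => ?_
    rw [hy s hs e, add_smul, Matrix.vecMulVec_mulVec]
    simp
  rw [estimator, hresp, Matrix.mulVec_add, Matrix.mulVec_sub, Matrix.mulVec_mulVec,
    Matrix.nonsing_inv_mul _ (isUnit_iff_ne_zero.mpr (gram_posDef hlam z t).det_pos.ne'),
    Matrix.one_mulVec, Matrix.mulVec_add, Matrix.mulVec_neg]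
  abel

/-- The `A`-norm of the error is the `A⁻¹`-norm of bias plus noise. Since `A ≥ λ I`, the bias `λ θ`
contributes at most `√λ S`. -/
theorem mem_confSet_of_noise_bound {σ lam δ L S : ℝ} (hlam : 0 < lam)
    {z : ℕ → E → Fin d × Fin d → ℝ} {y η : ℕ → E → ℝ} {θ : Fin d × Fin d → ℝ} {t : ℕ}
    (hy : ∀ s ∈ Finset.Icc 1 t, ∀ e, y s e = z s e ⬝ᵥ θ + η s e) (hθ : euclNorm θ ≤ S)
    (h : weightedNorm (gram lam z t)⁻¹ (response z η t) ≤
      σ * √((d : ℝ) ^ 2 * Real.log ((1 + t * Fintype.card E * L ^ 2 / lam) / δ))) :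
    θ ∈ confSet σ S L lam δ z y t := by
  have hA := gram_posDef hlam z t
  rw [confSet, Set.mem_ofPred_eq, estimator_sub_eq hlam z y η θ t hy, weightedNorm_inv_mulVec hA,
    confRadius, add_comm (σ * _)]
  refine (weightedNorm_add_le hA.inv _ _).trans (add_le_add ?_ ?_)
  · refine Real.sqrt_le_iff.mpr ⟨mul_nonneg (Real.sqrt_nonneg _)
      ((euclNorm_nonneg θ).trans hθ), ?_⟩
    refine (dotProduct_inv_mulVec_le hlam hA (posSemidef_sum_vecMulVec z t) rfl _).trans ?_
    rw [mul_pow, Real.sq_sqrt hlam.le, smul_dotProduct, dotProduct_smul, ← euclNorm_sq,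
      smul_eq_mul, smul_eq_mul, mul_div_assoc, mul_div_cancel_left₀ _ hlam.ne']
    gcongr
    exact euclNorm_nonneg θ
  · rw [← zero_sub, weightedNorm_sub_comm, sub_zero]
    exact h

end Confidence

/-! ### Sums over directed edges and the parameter `γ` -/

section Darts

variable {V : Type*} [Fintype V] (G : SimpleGraph V) [DecidableRel G.Adj]

theorem sum_dart_eq {R : Type*} [AddCommMonoid R] (f : V → V → R) :
    ∑ e : G.Dart, f e.fst e.snd = ∑ i, ∑ j, if G.Adj i j then f i j else 0 := by
  rw [← Finset.sum_product', ← Finset.sum_filter]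
  refine Finset.sum_bij (fun e _ => e.toProd) (fun e _ => by simp)
    (fun e _ e' _ h => SimpleGraph.Dart.toProd_injective h) (fun p hp => ?_) fun e _ => rfl
  exact ⟨⟨p, by simpa using hp⟩, Finset.mem_univ _, rfl⟩

theorem sum_dart_symm {R : Type*} [AddCommMonoid R] (f : G.Dart → R) :
    ∑ e : G.Dart, f e.symm = ∑ e, f e :=
  Equiv.sum_comp (Function.Involutive.toPerm _ SimpleGraph.Dart.symm_involutive) f

variable {d : ℕ} {X : Finset (Fin d → ℝ)} {M : Matrix (Fin d) (Fin d) ℝ} {xstar : V → Fin d → ℝ}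

theorem globalReward_nonneg (hM : ∀ x ∈ X, ∀ x' ∈ X, 0 ≤ meanReward M x x')
    {a : V → Fin d → ℝ} (ha : ∀ i, a i ∈ X) : 0 ≤ globalReward G M a :=
  Finset.sum_nonneg fun e _ => hM _ (ha e.fst) _ (ha e.snd)

theorem gammaParam_nonneg (hX : X.Nonempty) (hM : ∀ x ∈ X, ∀ x' ∈ X, 0 ≤ meanReward M x x')
    (hx : ∀ i, xstar i ∈ X) : 0 ≤ gammaParam G X hX M xstar :=
  Finset.le_inf' _ _ fun x hxX => by
    rw [edgeArm_dotProduct_vec]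
    have := globalReward_nonneg G hM hx
    have := hM x hxX x hxX
    positivity

/-- Playing one arm `x` on every node is feasible, so its average edge reward `⟨z_{xx}, θ⋆⟩` cannot
exceed the optimal average. -/
theorem gammaParam_le_one (hX : X.Nonempty) (hM : ∀ x ∈ X, ∀ x' ∈ X, 0 ≤ meanReward M x x')
    (hx : IsOptimalJointArm G X M xstar) : gammaParam G X hX M xstar ≤ 1 := by
  obtain ⟨x, hxX⟩ := hX
  refine (Finset.inf'_le _ hxX).trans ?_
  rw [edgeArm_dotProduct_vec]
  have h0 := globalReward_nonneg G hM hx.1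
  -- Without edges the denominator is `0`, and division by zero returns `0`, the convention chosen
  -- for `γ`.
  rcases Nat.eq_zero_or_pos (numEdges G) with hm | hm
  · simp [hm]
  refine div_le_one_of_le₀ ?_ (by positivity)
  have h := hx.2 (fun _ => x) fun _ => hxX
  have h2 : globalReward G M (fun _ => x) = numEdges G * meanReward M x x := by
    simp [globalReward, numEdges]
  rw [h2] at h
  have hm' : (0 : ℝ) < numEdges G := by exact_mod_cast hm
  rw [one_div, ← div_eq_inv_mul, le_div_iff₀ hm']
  linarith

/-- Guarantees the reward of an uncut edge. If the optimal average is `0`, nonnegativity of the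
rewards replaces the definition of `γ`. -/
theorem gammaParam_mul_le (hX : X.Nonempty) (hM : ∀ x ∈ X, ∀ x' ∈ X, 0 ≤ meanReward M x x')
    (hx : ∀ i, xstar i ∈ X) {u : Fin d → ℝ} (hu : u ∈ X) :
    gammaParam G X hX M xstar * (1 / numEdges G * globalReward G M xstar) ≤ meanReward M u u := by
  have h0 : 0 ≤ 1 / numEdges G * globalReward G M xstar := by
    have := globalReward_nonneg G hM hx
    positivity
  rcases h0.eq_or_lt with h | h
  · rw [← h, mul_zero]; exact hM u hu u hu
  · rw [← le_div_iff₀ h, ← edgeArm_dotProduct_vec]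
    exact Finset.inf'_le _ hu

end Darts

/-! ### The greedy cut and the regret of one round -/

section Cut

variable {V : Type*} [Fintype V] [DecidableEq V] (G : SimpleGraph V) [DecidableRel G.Adj]

/-- The sign of a node in a partial cut: `1` on `V₁`, `-1` on `V₂`, `0` elsewhere. -/
def cutSign (P : Finset V × Finset V) (i : V) : ℤ :=
  (if i ∈ P.1 then 1 else 0) - if i ∈ P.2 then 1 else 0

/-- The number of uncut directed edges minus the number of cut directed edges. -/
def cutDefect (χ : V → ℤ) : ℤ := ∑ i, ∑ j, if G.Adj i j then χ i * χ j else 0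

/-- Only the terms with exactly one end at `k` change, because there are no loops; symmetry of
adjacency counts each of them twice. -/
theorem cutDefect_add_single (χ : V → ℤ) (k : V) (s : ℤ) :
    cutDefect G (χ + Pi.single k s) =
      cutDefect G χ + 2 * s * ∑ j, if G.Adj k j then χ j else 0 := by
  have h1 : ∀ i j : V, (if G.Adj i j then (χ + Pi.single k s : V → ℤ) i * (χ + Pi.single k s : V → ℤ) j else 0) =
      (if G.Adj i j then χ i * χ j else 0) +
      ((if i = k then s * (if G.Adj k j then χ j else 0) else 0) +
      (if j = k then s * (if G.Adj k i then χ i else 0) else 0)) := by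
    intro i j
    by_cases hij : G.Adj i j
    · have hji := hij.symm
      by_cases hi : i = k
      · subst hi
        have hj : j ≠ i := hji.ne
        simp [hij, hj]; ring
      · by_cases hj : j = k
        · subst hj; simp [hij, hji, hi]; ring
        · simp [hij, hi, hj]
    · have hji : ¬ G.Adj j i := fun h => hij h.symm
      by_cases hi : i = k
      · subst hi
        by_cases hj : j = i <;> simp [hij, hj]
      · by_cases hj : j = k
        · subst hj; simp [hij, hji, hi]
        · simp [hij, hi, hj]
  unfold cutDefect
  simp only [h1, Finset.sum_add_distrib, Finset.sum_ite_eq', Finset.mem_univ, if_true]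
  rw [Finset.sum_comm (f := fun i j => if i = k then s * (if G.Adj k j then χ j else 0) else 0)]
  simp only [Finset.sum_ite_eq', Finset.mem_univ, if_true, ← Finset.mul_sum]
  ring

theorem sum_cutSign_eq (P : Finset V × Finset V) (k : V) :
    (∑ j, if G.Adj k j then cutSign P j else 0) =
      ((P.1.filter fun j => G.Adj k j).card : ℤ) - (P.2.filter fun j => G.Adj k j).card := by
  have h : ∀ Q : Finset V, ((Q.filter fun j => G.Adj k j).card : ℤ) =
      ∑ j, if G.Adj k j then (if j ∈ Q then 1 else 0) else 0 := by
    intro Q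
    rw [Finset.card_filter, Nat.cast_sum, ← Finset.univ_inter Q, ← Finset.sum_ite_mem]
    refine Finset.sum_congr rfl fun j _ => ?_
    by_cases h : G.Adj k j <;> simp [h]
  rw [h, h, ← Finset.sum_sub_distrib]
  refine Finset.sum_congr rfl fun j _ => ?_
  by_cases h : G.Adj k j <;> simp [h, cutSign]

/-- The greedy rule gives the new node a sign opposite to the sum of its neighbours' signs, so the
change of the defect is nonpositive. -/
theorem cutStep_spec {P : Finset V × Finset V} {k : V} (h1 : k ∉ P.1) (h2 : k ∉ P.2)
    (hdisj : Disjoint P.1 P.2) :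
    cutDefect G (cutSign (cutStep G P k)) ≤ cutDefect G (cutSign P) ∧
      Disjoint (cutStep G P k).1 (cutStep G P k).2 ∧
      (cutStep G P k).1 ∪ (cutStep G P k).2 = insert k (P.1 ∪ P.2) := by
  unfold cutStep
  split_ifs with h
  · have hs : cutSign (P.1, insert k P.2) = cutSign P + Pi.single k (-1) := by
      ext i
      by_cases hi : i = k
      · subst hi; simp [cutSign, h1, h2]
      · simp [cutSign, hi]
    refine ⟨?_, by simp [h1, hdisj], by simp [Finset.union_insert]⟩
    rw [hs, cutDefect_add_single, sum_cutSign_eq]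
    omega
  · have hs : cutSign (insert k P.1, P.2) = cutSign P + Pi.single k 1 := by
      ext i
      by_cases hi : i = k
      · subst hi; simp [cutSign, h1, h2]
      · simp [cutSign, hi]
    refine ⟨?_, by simp [h2, hdisj], by simp [Finset.insert_union]⟩
    rw [hs, cutDefect_add_single, sum_cutSign_eq]
    omega

theorem foldl_cutStep_spec (l : List V) : ∀ P : Finset V × Finset V, l.Nodup →
    (∀ v ∈ l, v ∉ P.1 ∪ P.2) → Disjoint P.1 P.2 →
    cutDefect G (cutSign (l.foldl (cutStep G) P)) ≤ cutDefect G (cutSign P) ∧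
      Disjoint (l.foldl (cutStep G) P).1 (l.foldl (cutStep G) P).2 ∧
      (l.foldl (cutStep G) P).1 ∪ (l.foldl (cutStep G) P).2 = l.toFinset ∪ (P.1 ∪ P.2) := by
  induction l with
  | nil => intro P _ _ h; simpa using h
  | cons k l ih =>
    intro P hl hP hdisj
    have hk := hP k (by simp)
    rw [Finset.mem_union, not_or] at hk
    obtain ⟨hkl, hl'⟩ := List.nodup_cons.mp hl
    obtain ⟨a1, a2, a3⟩ := cutStep_spec G hk.1 hk.2 hdisj
    obtain ⟨b1, b2, b3⟩ := ih (cutStep G P k) hl' (fun v hv => by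
      rw [a3, Finset.mem_insert, not_or]
      exact ⟨fun h => hkl (h ▸ hv), hP v (List.mem_cons_of_mem _ hv)⟩) a2
    refine ⟨b1.trans a1, b2, ?_⟩
    rw [List.foldl_cons, b3, a3]
    simp [Finset.insert_union, Finset.union_insert]

/-- The directed edges between the two sides of a cut. -/
def cutDarts (P : Finset V × Finset V) : Finset G.Dart :=
  Finset.univ.filter fun e => ¬(e.fst ∈ P.1 ↔ e.snd ∈ P.1)

/-- The defect starts at `0`, never increases, and equals `m - 2 c` once every node is placed. -/
theorem numEdges_le_two_mul_card_cutDarts {order : List V} (hnodup : order.Nodup)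
    (hmem : ∀ v, v ∈ order) :
    numEdges G ≤ 2 * (cutDarts G (approxMaxCut G order)).card := by
  obtain ⟨h1, h2, h3⟩ := foldl_cutStep_spec G order (∅, ∅) hnodup (by simp) (by simp)
  set P := approxMaxCut G order with hP
  change cutDefect G (cutSign P) ≤ _ at h1
  change Disjoint P.1 P.2 at h2
  change P.1 ∪ P.2 = _ at h3
  have h0 : cutDefect G (cutSign ((∅, ∅) : Finset V × Finset V)) = 0 := by
    simp [cutDefect, cutSign]
  have hsign : ∀ i, cutSign P i = if i ∈ P.1 then 1 else -1 := by
    intro i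
    have hi : i ∈ P.1 ∪ P.2 := by rw [h3]; simp [hmem]
    by_cases h : i ∈ P.1
    · simp [cutSign, h, Finset.disjoint_left.mp h2 h]
    · have : i ∈ P.2 := (Finset.mem_union.mp hi).resolve_left h
      simp [cutSign, h, this]
  have hsum : cutDefect G (cutSign P) = (numEdges G : ℤ) - 2 * (cutDarts G P).card := by
    rw [cutDefect, ← sum_dart_eq G fun i j => cutSign P i * cutSign P j, numEdges,
      ← Finset.card_univ, cutDarts, Finset.card_filter, Finset.card_eq_sum_ones]
    push_cast
    rw [Finset.mul_sum, ← Finset.sum_sub_distrib]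
    refine Finset.sum_congr rfl fun e _ => ?_
    rw [hsign, hsign]
    by_cases h : e.fst ∈ P.1 <;> by_cases h' : e.snd ∈ P.1 <;> simp [h, h']
  rw [h0, hsum] at h1
  omega

variable {d : ℕ}

/-- Reversal permutes the cut directed edges, and each one together with its reverse carries both `φ
u u'` and `φ u' u`. -/
theorem two_mul_sum_cutDarts (P : Finset V × Finset V) (u u' : Fin d → ℝ)
    (φ : (Fin d → ℝ) → (Fin d → ℝ) → ℝ) :
    2 * ∑ e ∈ cutDarts G P, φ (allocate P u u' e.fst) (allocate P u u' e.snd) =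
      (cutDarts G P).card * (φ u u' + φ u' u) := by
  have h1 : ∑ e ∈ cutDarts G P, φ (allocate P u u' e.fst) (allocate P u u' e.snd) =
      ∑ e ∈ cutDarts G P, φ (allocate P u u' e.snd) (allocate P u u' e.fst) := by
    rw [cutDarts, Finset.sum_filter, Finset.sum_filter, ← sum_dart_symm]
    refine Finset.sum_congr rfl fun e _ => ?_
    simp only [SimpleGraph.Dart.symm_toProd, Prod.fst_swap, Prod.snd_swap]
    exact if_congr (not_congr iff_comm) rfl rfl
  rw [two_mul]
  nth_rw 2 [h1]
  rw [← Finset.sum_add_distrib, ← nsmul_eq_mul, ← Finset.sum_const]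
  refine Finset.sum_congr rfl fun e he => ?_
  have he' := (Finset.mem_filter.mp he).2
  by_cases h : e.fst ∈ P.1 <;> by_cases h' : e.snd ∈ P.1 <;> simp [h, h', allocate] at he' ⊢
  ring

variable {X : Finset (Fin d → ℝ)} {M : Matrix (Fin d) (Fin d) ℝ} {xstar : V → Fin d → ℝ}

/-- The regret of one round is controlled by the optimism of the cut edges. -/
theorem round_regret_le (hX : X.Nonempty) (hM : ∀ x ∈ X, ∀ x' ∈ X, 0 ≤ meanReward M x x')
    (hx : IsOptimalJointArm G X M xstar) {P : Finset V × Finset V}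
    (hP : numEdges G ≤ 2 * (cutDarts G P).card) {u u' : Fin d → ℝ} (hu : u ∈ X) (hu' : u' ∈ X)
    {θ : Fin d × Fin d → ℝ}
    (hopt : ∀ v ∈ X, ∀ v' ∈ X, (edgeArm v v' + edgeArm v' v) ⬝ᵥ M.vec ≤
      (edgeArm u u' + edgeArm u' u) ⬝ᵥ θ) :
    ∑ e : G.Dart, ((1 + gammaParam G X hX M xstar) / 2 *
        meanReward M (xstar e.fst) (xstar e.snd) -
        meanReward M (allocate P u u' e.fst) (allocate P u u' e.snd)) ≤
      ∑ e ∈ cutDarts G P,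
        edgeArm (allocate P u u' e.fst) (allocate P u u' e.snd) ⬝ᵥ (θ - M.vec) := by
  set γ := gammaParam G X hX M xstar with hγ
  have hγ0 : 0 ≤ γ := gammaParam_nonneg G hX hM hx.1
  have hγ1 : γ ≤ 1 := gammaParam_le_one G hX hM hx
  set o : ℝ := 1 / numEdges G * globalReward G M xstar with ho
  set m : ℝ := (numEdges G : ℝ) with hm
  set c : ℝ := ((cutDarts G P).card : ℝ) with hc
  set B := (edgeArm u u' + edgeArm u' u) ⬝ᵥ θ with hB
  set s := meanReward M u u' + meanReward M u' u with hs
  have hmc : m ≤ 2 * c := by rw [hm, hc]; exact_mod_cast hP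
  have hm0 : 0 ≤ m := Nat.cast_nonneg _
  have ho0 : 0 ≤ o := by
    have := globalReward_nonneg G hM hx.1
    positivity
  have hpair : ∀ v ∈ X, ∀ v' ∈ X, meanReward M v v' + meanReward M v' v ≤ B := by
    intro v hv v' hv'
    simpa only [add_dotProduct, edgeArm_dotProduct_vec] using hopt v hv v' hv'
  have hmo : m * o = globalReward G M xstar := by
    rcases Nat.eq_zero_or_pos (numEdges G) with h | h
    · have : IsEmpty G.Dart := Fintype.card_eq_zero_iff.mp h
      simp [globalReward, hm, h]
    · have : m ≠ 0 := by rw [hm]; exact_mod_cast h.ne'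
      rw [ho, ← mul_assoc, mul_one_div_cancel this, one_mul]
  -- Optimism is applied to the two arms that the optimal allocation puts on each edge, then summed
  -- over directed edges and their reverses.
  have hoB : 2 * o ≤ B := by
    have h2 : 2 * globalReward G M xstar ≤ m * B := by
      rw [two_mul]
      nth_rw 2 [globalReward]
      rw [← sum_dart_symm, globalReward, ← Finset.sum_add_distrib, hm, numEdges,
        ← Finset.card_univ, ← nsmul_eq_mul, ← Finset.sum_const]
      exact Finset.sum_le_sum fun e _ => hpair _ (hx.1 _) _ (hx.1 _)
    rw [← hmo] at h2
    rcases hm0.eq_or_lt with h | h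
    · have : o = 0 := by rw [ho, ← h]; simp
      rw [this, mul_zero]
      exact (add_nonneg (hM u hu u' hu') (hM u' hu' u hu)).trans (hpair u hu u' hu')
    · nlinarith
  have hcm : c + ((Finset.univ.filter fun e : G.Dart =>
      ¬¬(e.fst ∈ P.1 ↔ e.snd ∈ P.1)).card : ℝ) = m := by
    rw [hc, hm, cutDarts, numEdges, ← Finset.card_univ]
    exact_mod_cast Finset.card_filter_add_card_filter_not _
  have hreward : c / 2 * s + (m - c) * (γ * o) ≤
      ∑ e : G.Dart, meanReward M (allocate P u u' e.fst) (allocate P u u' e.snd) := by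
    rw [← Finset.sum_filter_add_sum_filter_not Finset.univ
      (fun e : G.Dart => ¬(e.fst ∈ P.1 ↔ e.snd ∈ P.1))]
    refine add_le_add (le_of_eq ?_) ?_
    · have := two_mul_sum_cutDarts G P u u' (meanReward M)
      rw [← hc, ← hs, cutDarts] at this
      linarith
    · rw [← hcm, add_sub_cancel_left, ← nsmul_eq_mul, ← Finset.sum_const]
      refine Finset.sum_le_sum fun e he => ?_
      have he' := not_not.mp (Finset.mem_filter.mp he).2
      by_cases h : e.fst ∈ P.1
      · simp only [allocate, h, he'.mp h, if_true]
        exact gammaParam_mul_le G hX hM hx.1 hu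
      · have h' : e.snd ∉ P.1 := fun h' => h (he'.mpr h')
        simp only [allocate, h, h', if_false]
        exact gammaParam_mul_le G hX hM hx.1 hu'
  have hright : ∑ e ∈ cutDarts G P,
      edgeArm (allocate P u u' e.fst) (allocate P u u' e.snd) ⬝ᵥ (θ - M.vec) = c / 2 * (B - s) := by
    have := two_mul_sum_cutDarts G P u u' fun a b => edgeArm a b ⬝ᵥ (θ - M.vec)
    rw [hB, hs, ← edgeArm_dotProduct_vec, ← edgeArm_dotProduct_vec, add_dotProduct]
    simp only [dotProduct_sub] at this ⊢
    linarith
  rw [hright, Finset.sum_sub_distrib, ← Finset.mul_sum]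
  change (1 + γ) / 2 * globalReward G M xstar - _ ≤ _
  rw [← hmo]
  -- The only use of the cut guarantee `c ≥ m / 2`; it is what makes `(1 + γ) / 2` the attainable
  -- ratio.
  have h1 : o * (γ * (c - m / 2)) ≤ o * (1 * (c - m / 2)) := by
    gcongr
    linarith
  have h2 : c / 2 * (2 * o) ≤ c / 2 * B := by
    have : 0 ≤ c := Nat.cast_nonneg _
    gcongr
  nlinarith

end Cut

/-! ### Elliptical potential and the number of exceptional rounds -/

section Potential

/-- If the increments of `ℓ` dominate `log (1 + W)`, then a sum whose terms are at most `b √W` and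
at most `K` is controlled by the total growth of `ℓ`, up to the steps where `W` exceeds `1`. -/
theorem sum_le_sqrt_growth_add (T : ℕ) (ρ W ℓ : ℕ → ℝ) {b K : ℝ} (hb : 0 ≤ b)
    (hW : ∀ t < T, 0 ≤ W t) (hρW : ∀ t < T, ρ t ≤ b * √(W t)) (hρK : ∀ t < T, ρ t ≤ K)
    (hℓ : ∀ t < T, Real.log (1 + W t) ≤ ℓ (t + 1) - ℓ t) :
    ∑ t ∈ Finset.range T, ρ t ≤ b * √(2 * T * (ℓ T - ℓ 0)) +
      K * ((Finset.range T).filter fun t => 1 < W t).card := by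
  have hinc : ∀ t < T, 0 ≤ ℓ (t + 1) - ℓ t := fun t ht =>
    (Real.log_nonneg (by linarith [hW t ht])).trans (hℓ t ht)
  have hgood : ∀ t ∈ (Finset.range T).filter fun t => ¬ 1 < W t,
      W t ≤ 2 * (ℓ (t + 1) - ℓ t) := by
    intro t ht
    obtain ⟨ht, h1⟩ := Finset.mem_filter.mp ht
    have ht := Finset.mem_range.mp ht
    have h0 := hW t ht
    have h2 := Real.one_sub_inv_le_log_of_pos (show 0 < 1 + W t by linarith)
    -- For `W ≤ 1`, `W / 2 ≤ W / (1 + W) = 1 - 1 / (1 + W) ≤ log (1 + W)`; this is the origin of the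
    -- factor `2`.
    have h3 : W t / 2 ≤ 1 - (1 + W t)⁻¹ := by
      have h4 : 1 - (1 + W t)⁻¹ = W t / (1 + W t) := by field_simp; ring
      rw [h4]
      exact div_le_div_of_nonneg_left h0 (by linarith) (by linarith)
    linarith [hℓ t ht]
  have hsumW : ∑ t ∈ (Finset.range T).filter (fun t => ¬ 1 < W t), W t ≤ 2 * (ℓ T - ℓ 0) := by
    refine (Finset.sum_le_sum hgood).trans ?_
    rw [← Finset.mul_sum, ← Finset.sum_range_sub]
    refine mul_le_mul_of_nonneg_left ?_ zero_le_two
    exact Finset.sum_le_sum_of_subset_of_nonneg (Finset.filter_subset _ _)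
      fun t ht _ => hinc t (Finset.mem_range.mp ht)
  have hsqrt : ∑ t ∈ (Finset.range T).filter (fun t => ¬ 1 < W t), √(W t) ≤
      √(2 * T * (ℓ T - ℓ 0)) := by
    refine Real.le_sqrt_of_sq_le ?_
    refine (sq_sum_le_card_mul_sum_sq).trans ?_
    have h1 : ∑ t ∈ (Finset.range T).filter (fun t => ¬ 1 < W t), √(W t) ^ 2 ≤
        2 * (ℓ T - ℓ 0) := by
      refine le_trans (le_of_eq (Finset.sum_congr rfl fun t ht => ?_)) hsumW
      exact Real.sq_sqrt (hW t (Finset.mem_range.mp (Finset.mem_filter.mp ht).1))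
    have h2 : (((Finset.range T).filter fun t => ¬ 1 < W t).card : ℝ) ≤ T := by
      exact_mod_cast (Finset.card_filter_le _ _).trans_eq (Finset.card_range T)
    calc _ ≤ (T : ℝ) * (2 * (ℓ T - ℓ 0)) :=
          mul_le_mul h2 h1 (Finset.sum_nonneg fun _ _ => sq_nonneg _) (Nat.cast_nonneg _)
      _ = _ := by ring
  rw [← Finset.sum_filter_not_add_sum_filter (Finset.range T) (fun t => 1 < W t)]
  refine add_le_add ?_ ?_
  · refine le_trans (Finset.sum_le_sum fun t ht =>
      hρW t (Finset.mem_range.mp (Finset.mem_filter.mp ht).1)) ?_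
    rw [← Finset.mul_sum]
    exact mul_le_mul_of_nonneg_left hsqrt hb
  · rw [mul_comm, ← nsmul_eq_mul, ← Finset.sum_const]
    exact Finset.sum_le_sum fun t ht => hρK t (Finset.mem_range.mp (Finset.mem_filter.mp ht).1)

theorem card_mul_log_two_le_growth (T : ℕ) (W ℓ : ℕ → ℝ) (hW : ∀ t < T, 0 ≤ W t)
    (hℓ : ∀ t < T, Real.log (1 + W t) ≤ ℓ (t + 1) - ℓ t) :
    ((Finset.range T).filter fun t => 1 < W t).card * Real.log 2 ≤ ℓ T - ℓ 0 := by
  rw [← nsmul_eq_mul, ← Finset.sum_const, ← Finset.sum_range_sub]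
  refine (Finset.sum_le_sum fun t ht => ?_).trans
    (Finset.sum_le_sum_of_subset_of_nonneg (Finset.filter_subset _ _) fun t ht _ => ?_)
  · obtain ⟨ht, h1⟩ := Finset.mem_filter.mp ht
    exact (Real.log_le_log two_pos (by linarith)).trans (hℓ t (Finset.mem_range.mp ht))
  · have ht := Finset.mem_range.mp ht
    exact (Real.log_nonneg (by linarith [hW t ht])).trans (hℓ t ht)

/-- Converts the growth bound, which involves `1 + u / D`, into one involving `u / δ`. For `u ≥ 4 /
3` and `D ≥ 4`, `1 + u / D ≤ 1 + u / 4 ≤ u`. For `u ≤ 1` no round is exceptional, and the range in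
between is settled by integrality. -/
theorem natCast_le_max_ceil {D N : ℕ} {u δ : ℝ} (hD : 4 ≤ D) (hδ : 0 < δ) (hδ1 : δ ≤ 1)
    (hN1 : u ≤ 1 → N = 0) (hN : N * Real.log 2 ≤ D * Real.log (1 + u / D)) :
    (N : ℝ) ≤ ((max 0 ⌈(D : ℝ) * Real.logb 2 (u / δ)⌉ : ℤ) : ℝ) := by
  rcases le_or_gt u 1 with hu | hu
  · rw [hN1 hu]
    exact_mod_cast le_max_left _ _
  have hD4 : (4 : ℝ) ≤ D := by exact_mod_cast hD
  have hlog2 : 0 < Real.log 2 := Real.log_pos one_lt_two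
  have hle : Real.logb 2 u ≤ Real.logb 2 (u / δ) := by
    refine Real.logb_le_logb_of_le one_lt_two (by linarith) ?_
    rw [le_div_iff₀ hδ]
    nlinarith
  have hlogu : 0 < Real.logb 2 u := Real.logb_pos one_lt_two hu
  have hpos : 0 < (D : ℝ) * Real.logb 2 (u / δ) := by
    have := hlogu.trans_le hle
    positivity
  rcases le_or_gt (4 / 3) u with h | h
  · have h1 : 1 + u / D ≤ u := by
      have : u / D ≤ u / 4 := div_le_div_of_nonneg_left (by linarith) (by norm_num) hD4
      linarith
    have h2 : (N : ℝ) ≤ D * Real.logb 2 u := by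
      rw [← Real.log_div_log, ← mul_div_assoc, le_div_iff₀ hlog2]
      refine hN.trans ?_
      gcongr
    have h3 : (N : ℝ) ≤ (⌈(D : ℝ) * Real.logb 2 (u / δ)⌉ : ℝ) :=
      h2.trans ((mul_le_mul_of_nonneg_left hle (by linarith)).trans (Int.le_ceil _))
    exact h3.trans (by exact_mod_cast le_max_right _ _)
  -- Here `1 < u < 4 / 3`, so `N log 2 ≤ u < 4 / 3 < 2 log 2` forces `N ≤ 1`, while the ceiling of a
  -- positive number is at least `1`.
  · have h1 : (D : ℝ) * Real.log (1 + u / D) ≤ u := by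
      have h2 := Real.log_le_sub_one_of_pos (show 0 < 1 + u / D by positivity)
      calc (D : ℝ) * Real.log (1 + u / D) ≤ D * (u / D) := by gcongr; linarith
        _ = u := by field_simp
    have hN2 : N < 2 := by
      by_contra hcon
      have h3 : (2 : ℝ) ≤ N := by exact_mod_cast not_lt.mp hcon
      have := Real.log_two_gt_d9
      nlinarith
    have hceil : 1 ≤ ⌈(D : ℝ) * Real.logb 2 (u / δ)⌉ := Int.one_le_ceil_iff.mpr hpos
    have h4 : (N : ℤ) ≤ max 0 ⌈(D : ℝ) * Real.logb 2 (u / δ)⌉ := by omega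
    exact_mod_cast h4

end Potential

/-! ### Deterministic regret bound on the confidence event -/

section Regret

variable {E : Type*} [Fintype E] {d : ℕ}

theorem log_one_add_le_log_det_sub {lam : ℝ} (hlam : 0 < lam) (z : ℕ → E → Fin d × Fin d → ℝ)
    (t : ℕ) :
    Real.log (1 + ∑ e, z (t + 1) e ⬝ᵥ (gram lam z t)⁻¹ *ᵥ z (t + 1) e) ≤
      Real.log (gram lam z (t + 1)).det - Real.log (gram lam z t).det := by
  have h0 := (gram_posDef hlam z t).det_pos
  have hW : 0 ≤ ∑ e, z (t + 1) e ⬝ᵥ (gram lam z t)⁻¹ *ᵥ z (t + 1) e :=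
    Finset.sum_nonneg fun e _ => by
      simpa using (gram_posDef hlam z t).inv.posSemidef.dotProduct_mulVec_nonneg (z (t + 1) e)
  rw [le_sub_iff_add_le, ← Real.log_mul (by linarith) h0.ne', gram_succ]
  refine Real.log_le_log (by positivity) ?_
  rw [mul_comm]
  exact det_mul_one_add_sum_le_det_add (gram_posDef hlam z t) _

theorem log_det_gram_sub_le {lam : ℝ} (hlam : 0 < lam) (hd : 0 < d)
    (z : ℕ → E → Fin d × Fin d → ℝ) (t : ℕ) {L : ℝ}
    (hz : ∀ s ∈ Finset.Icc 1 t, ∀ e, euclNorm (z s e) ≤ L) :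
    Real.log (gram lam z t).det - Real.log (gram lam z 0).det ≤
      (d : ℝ) ^ 2 * Real.log (1 + (t * Fintype.card E * L ^ 2 / lam) / (d : ℝ) ^ 2) := by
  have hg0 : (gram lam z 0).det = lam ^ d ^ 2 := by
    rw [gram_zero, Matrix.det_smul, Matrix.det_one, mul_one]; simp [pow_two]
  have h := Real.log_le_log (gram_posDef hlam z t).det_pos (det_gram_le hlam hd z t hz)
  rw [Real.log_mul (by positivity) (by positivity), Real.log_pow (1 + _)] at h
  rw [hg0]
  push_cast at h
  linarith

theorem confRadius_nonneg {m : ℕ} {σ S L lam δ : ℝ} (hσ : 0 ≤ σ) (hS : 0 ≤ S) (t : ℕ) :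
    0 ≤ confRadius d m σ S L lam δ t := by
  unfold confRadius
  positivity

theorem confRadius_mono {m : ℕ} {σ S L lam δ : ℝ} (hσ : 0 ≤ σ) (hlam : 0 < lam) (hδ : 0 < δ) :
    Monotone (confRadius d m σ S L lam δ) := by
  intro t t' h
  unfold confRadius
  gcongr

theorem dotProduct_sub_le_of_mem_confSet {σ S L lam δ : ℝ} (hlam : 0 < lam)
    {z : ℕ → E → Fin d × Fin d → ℝ} {y : ℕ → E → ℝ} {t : ℕ} {θ θ' : Fin d × Fin d → ℝ}
    (hθ : θ ∈ confSet σ S L lam δ z y t) (hθ' : θ' ∈ confSet σ S L lam δ z y t)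
    (v : Fin d × Fin d → ℝ) :
    v ⬝ᵥ (θ - θ') ≤ weightedNorm (gram lam z t)⁻¹ v *
      (2 * confRadius d (Fintype.card E) σ S L lam δ t) := by
  have hA := gram_posDef hlam z t
  refine (dotProduct_le_weightedNorm_mul hA _ _).trans
    (mul_le_mul_of_nonneg_left ?_ (weightedNorm_nonneg _ _))
  have h1 : θ - θ' = (θ - estimator lam z y t) + (estimator lam z y t - θ') := by abel
  rw [h1, two_mul]
  refine (weightedNorm_add_le hA _ _).trans (add_le_add hθ ?_)
  rw [weightedNorm_sub_comm]
  exact hθ'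

/-- Cauchy–Schwarz over the edges, after enlarging the cut edges to all edges, which are those
entering the Gram matrix. -/
theorem sum_weightedNorm_inv_le {lam : ℝ} (hlam : 0 < lam) (z : ℕ → E → Fin d × Fin d → ℝ)
    (t : ℕ) (s : Finset E) :
    ∑ e ∈ s, weightedNorm (gram lam z t)⁻¹ (z (t + 1) e) ≤
      √(Fintype.card E) * √(∑ e, z (t + 1) e ⬝ᵥ (gram lam z t)⁻¹ *ᵥ z (t + 1) e) := by
  have hA := (gram_posDef hlam z t).inv.posSemidef
  refine (Finset.sum_le_sum_of_subset_of_nonneg (Finset.subset_univ s)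
    fun e _ _ => weightedNorm_nonneg _ _).trans ?_
  rw [← Real.sqrt_mul (Nat.cast_nonneg _)]
  refine Real.le_sqrt_of_sq_le (sq_sum_le_card_mul_sum_sq.trans_eq ?_)
  rw [Finset.card_univ]
  simp only [weightedNorm_sq hA]

theorem euclNorm_vec (M : Matrix (Fin d) (Fin d) ℝ) : euclNorm M.vec = frobNorm M := by
  rw [euclNorm_eq_sqrt, frobNorm, dotProduct, Fintype.sum_prod_type, Finset.sum_comm]
  simp [Matrix.vec, pow_two]

theorem meanReward_le {M : Matrix (Fin d) (Fin d) ℝ} {S L : ℝ} (hS : frobNorm M ≤ S)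
    {x x' : Fin d → ℝ} (hL : euclNorm (edgeArm x x') ≤ L) : meanReward M x x' ≤ L * S := by
  rw [← edgeArm_dotProduct_vec]
  refine (dotProduct_le_euclNorm_mul _ _).trans ?_
  rw [euclNorm_vec]
  exact mul_le_mul hL hS (Real.sqrt_nonneg _) ((euclNorm_nonneg _).trans hL)

theorem measurable_edgeArm {Ω : Type*} {m : MeasurableSpace Ω} {x x' : Ω → Fin d → ℝ}
    (hx : Measurable x) (hx' : Measurable x') : Measurable fun ω => edgeArm (x ω) (x' ω) := by
  refine measurable_pi_lambda _ fun p => ?_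
  simp only [edgeArm, Matrix.vec, Matrix.vecMulVec_apply]
  exact ((measurable_pi_apply _).comp hx).mul ((measurable_pi_apply _).comp hx')

theorem allocate_mem {V : Type*} [DecidableEq V] {X : Finset (Fin d → ℝ)}
    {P : Finset V × Finset V} {u u' : Fin d → ℝ} (hu : u ∈ X) (hu' : u' ∈ X) (i : V) :
    allocate P u u' i ∈ X := by
  unfold allocate
  split_ifs <;> assumption

variable {V : Type*} [Fintype V] [DecidableEq V] (G : SimpleGraph V) [DecidableRel G.Adj]
  {X : Finset (Fin d → ℝ)} {M : Matrix (Fin d) (Fin d) ℝ} {xstar : V → Fin d → ℝ}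

/-- The regret bound holds whenever the unknown parameter is in all the confidence sets. -/
theorem alphaRegret_le_regretBound {order : List V} (horder_nodup : order.Nodup)
    (horder_mem : ∀ v, v ∈ order) (hd : 2 ≤ d) (hX : X.Nonempty) {σ S L lam δ : ℝ} (hσ : 0 ≤ σ)
    (hlam : 0 < lam) (hδ_pos : 0 < δ) (hδ_le : δ ≤ 1)
    (hL : ∀ x ∈ X, ∀ x' ∈ X, euclNorm (edgeArm x x') ≤ L) (hS : frobNorm M ≤ S)
    (hM : ∀ x ∈ X, ∀ x' ∈ X, 0 ≤ meanReward M x x') (hxstar : IsOptimalJointArm G X M xstar)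
    {T : ℕ} {η : ℕ → G.Dart → ℝ} {x x' : ℕ → Fin d → ℝ}
    (hrun : IsRun G order X M σ S L lam δ T η x x')
    (hconf : ∀ t < T, M.vec ∈ confSet σ S L lam δ (playedArm G (approxMaxCut G order) x x')
      (observedReward G M (approxMaxCut G order) η x x') t) :
    alphaRegret G M xstar ((1 + gammaParam G X hX M xstar) / 2)
      (fun t => allocate (approxMaxCut G order) (x t) (x' t)) T ≤
      regretBound d (numEdges G) T σ S L lam δ := by
  set P := approxMaxCut G order with hP
  set z := playedArm G P x x' with hz
  set y := observedReward G M P η x x' with hy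
  have hS0 : 0 ≤ S := (Real.sqrt_nonneg _).trans hS
  obtain ⟨a, ha⟩ := hX
  have hL0 : 0 ≤ L := (euclNorm_nonneg _).trans (hL a ha a ha)
  have hX : X.Nonempty := ⟨a, ha⟩
  have hmem : ∀ t < T, ∀ i, allocate P (x (t + 1)) (x' (t + 1)) i ∈ X := fun t ht i =>
    allocate_mem (hrun t ht).1 (hrun t ht).2.1 i
  have hzL : ∀ t < T, ∀ e, euclNorm (z (t + 1) e) ≤ L := fun t ht e =>
    hL _ (hmem t ht e.fst) _ (hmem t ht e.snd)
  have hzL' : ∀ s ∈ Finset.Icc 1 T, ∀ e, euclNorm (z s e) ≤ L := by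
    intro s hs e
    obtain ⟨h1, h2⟩ := Finset.mem_Icc.mp hs
    obtain ⟨r, rfl⟩ : ∃ r, s = r + 1 := ⟨s - 1, by omega⟩
    exact hzL r (by omega) e
  set γ := gammaParam G X hX M xstar with hγ
  have hγ0 : 0 ≤ γ := gammaParam_nonneg G hX hM hxstar.1
  have hγ1 : γ ≤ 1 := gammaParam_le_one G hX hM hxstar
  set m : ℝ := (numEdges G : ℝ) with hm
  set u : ℝ := T * m * L ^ 2 / lam with hu
  set β := confRadius d (numEdges G) σ S L lam δ T with hβ
  have hβ0 : 0 ≤ β := confRadius_nonneg hσ hS0 T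
  set ρ : ℕ → ℝ := fun t => ∑ e : G.Dart, ((1 + γ) / 2 *
    meanReward M (xstar e.fst) (xstar e.snd) - meanReward M
      (allocate P (x (t + 1)) (x' (t + 1)) e.fst) (allocate P (x (t + 1)) (x' (t + 1)) e.snd))
    with hρ
  set W : ℕ → ℝ := fun t => ∑ e, z (t + 1) e ⬝ᵥ (gram lam z t)⁻¹ *ᵥ z (t + 1) e with hWdef
  set ℓ : ℕ → ℝ := fun t => Real.log (gram lam z t).det with hℓdef
  have hW0 : ∀ t < T, 0 ≤ W t := fun t _ => Finset.sum_nonneg fun e _ => by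
    simpa using (gram_posDef hlam z t).inv.posSemidef.dotProduct_mulVec_nonneg (z (t + 1) e)
  have hℓ : ∀ t < T, Real.log (1 + W t) ≤ ℓ (t + 1) - ℓ t := fun t _ =>
    log_one_add_le_log_det_sub hlam z t
  have hρW : ∀ t < T, ρ t ≤ 2 * β * √m * √(W t) := by
    intro t ht
    obtain ⟨hxX, hx'X, θ, hθ, hmax⟩ := hrun t ht
    have h1 := round_regret_le G hX hM hxstar
      (numEdges_le_two_mul_card_cutDarts G horder_nodup horder_mem) hxX hx'X (θ := θ)
      fun v hv v' hv' => hmax v hv v' hv' _ (hconf t ht)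
    refine h1.trans ?_
    calc ∑ e ∈ cutDarts G P, z (t + 1) e ⬝ᵥ (θ - M.vec)
        ≤ ∑ e ∈ cutDarts G P, weightedNorm (gram lam z t)⁻¹ (z (t + 1) e) * (2 * β) := by
          refine Finset.sum_le_sum fun e _ => ?_
          refine (dotProduct_sub_le_of_mem_confSet hlam hθ (hconf t ht) _).trans ?_
          refine mul_le_mul_of_nonneg_left ?_ (weightedNorm_nonneg _ _)
          exact mul_le_mul_of_nonneg_left (confRadius_mono hσ hlam hδ_pos ht.le) zero_le_two
      _ ≤ (√m * √(W t)) * (2 * β) := by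
          rw [← Finset.sum_mul]
          exact mul_le_mul_of_nonneg_right (sum_weightedNorm_inv_le hlam z t _) (by positivity)
      _ = _ := by ring
  have hρK : ∀ t < T, ρ t ≤ L * S * m := by
    intro t ht
    calc ρ t ≤ ∑ _e : G.Dart, L * S := by
          refine Finset.sum_le_sum fun e _ => ?_
          have h1 := hM _ (hmem t ht e.fst) _ (hmem t ht e.snd)
          have h2 := hM _ (hxstar.1 e.fst) _ (hxstar.1 e.snd)
          have h3 := meanReward_le hS (hL _ (hxstar.1 e.fst) _ (hxstar.1 e.snd))
          nlinarith
      _ = L * S * m := by simp [hm, numEdges, mul_comm]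
  have hgrow : ℓ T - ℓ 0 ≤ (d : ℝ) ^ 2 * Real.log (1 + u / (d : ℝ) ^ 2) :=
    log_det_gram_sub_le hlam (by omega) z T hzL'
  have hcount := card_mul_log_two_le_growth T W ℓ hW0 hℓ
  set N := ((Finset.range T).filter fun t => 1 < W t).card with hN
  -- Since `A ≥ λ I`, each round has `W ≤ m L² / λ`, which is at most `u` as soon as there is a
  -- round.
  have hN1 : u ≤ 1 → N = 0 := by
    intro hu1
    rw [hN, Finset.card_eq_zero, Finset.filter_eq_empty_iff]
    intro t ht
    have ht := Finset.mem_range.mp ht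
    rw [not_lt]
    refine le_trans ?_ hu1
    have hT1 : (1 : ℝ) ≤ T := by exact_mod_cast (by omega : 1 ≤ T)
    calc W t ≤ ∑ _e : G.Dart, L ^ 2 / lam := by
          refine Finset.sum_le_sum fun e _ => ?_
          refine (dotProduct_inv_mulVec_le hlam (gram_posDef hlam z t)
            (posSemidef_sum_vecMulVec z t) rfl _).trans ?_
          rw [← euclNorm_sq]
          gcongr
          · exact euclNorm_nonneg _
          · exact hzL t ht e
      _ = 1 * m * L ^ 2 / lam := by simp [hm, numEdges, mul_div_assoc]
      _ ≤ u := by rw [hu]; gcongr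
  have hNle : (N : ℝ) ≤ ((max 0 ⌈(d : ℝ) ^ 2 * Real.logb 2 (u / δ)⌉ : ℤ) : ℝ) := by
    have h := natCast_le_max_ceil (D := d ^ 2) (N := N) (u := u) (by nlinarith) hδ_pos hδ_le hN1
      (by push_cast; exact hcount.trans hgrow)
    push_cast at h ⊢
    exact h
  have hsum : alphaRegret G M xstar ((1 + γ) / 2) (fun t => allocate P (x t) (x' t)) T =
      ∑ t ∈ Finset.range T, ρ t := by
    rw [alphaRegret, Finset.range_eq_Ico, Finset.sum_Ico_add' (fun t => ∑ e : G.Dart,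
      ((1 + γ) / 2 * meanReward M (xstar e.fst) (xstar e.snd) - meanReward M
        (allocate P (x t) (x' t) e.fst) (allocate P (x t) (x' t) e.snd))) 0 T 1]
    rfl
  rw [hsum]
  refine (sum_le_sqrt_growth_add T ρ W ℓ (by positivity) hW0 hρW hρK hℓ).trans ?_
  refine add_le_add ?_ (mul_le_mul_of_nonneg_left hNle (by positivity))
  have hlog0 : 0 ≤ Real.log (1 + u / (d : ℝ) ^ 2) :=
    Real.log_nonneg (le_add_of_nonneg_right (by positivity))
  have hmax : (2 : ℝ) ≤ max 2 ((L * S) ^ 2) := le_max_left _ _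
  calc 2 * β * √m * √(2 * T * (ℓ T - ℓ 0))
      = √(2 ^ 2 * (m * (2 * T * (ℓ T - ℓ 0)))) * β := by
        rw [Real.sqrt_mul (sq_nonneg (2 : ℝ)), Real.sqrt_sq zero_le_two,
          Real.sqrt_mul (show 0 ≤ m from Nat.cast_nonneg _)]
        ring
    _ ≤ √(32 * T * m * (d : ℝ) ^ 2 * max 2 ((L * S) ^ 2) *
        Real.log (1 + u / (d : ℝ) ^ 2)) * β := by
        refine mul_le_mul_of_nonneg_right (Real.sqrt_le_sqrt ?_) hβ0
        calc 2 ^ 2 * (m * (2 * T * (ℓ T - ℓ 0)))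
            ≤ 2 ^ 2 * (m * (2 * T * ((d : ℝ) ^ 2 * Real.log (1 + u / (d : ℝ) ^ 2)))) := by
              gcongr
          _ = 4 * T * m * (d : ℝ) ^ 2 * 2 * Real.log (1 + u / (d : ℝ) ^ 2) := by ring
          -- There is slack here: the argument yields `8` where the stated bound has `32 max(2,
          -- (LS)²) ≥ 64`.
          _ ≤ _ := by gcongr; norm_num

end Regret

end GraphicalBilinearBandit

/-! ### The theorem: concentration combined with the deterministic bound -/

theorem theorem3p2
    -- the graph, and the order in which the greedy cut treats the nodes
    {V : Type*} [Fintype V] [DecidableEq V] (G : SimpleGraph V) [DecidableRel G.Adj]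
    (order : List V) (horder_nodup : order.Nodup) (horder_mem : ∀ v, v ∈ order)
    -- the arm set, the unknown matrix and the parameters
    {d : ℕ} (hd : 2 ≤ d)
    (X : Finset (Fin d → ℝ)) (hX : X.Nonempty)
    (M : Matrix (Fin d) (Fin d) ℝ)
    (σ S L lam δ : ℝ) (hσ : 0 ≤ σ) (hlam : 0 < lam) (hδ_pos : 0 < δ) (hδ_le : δ ≤ 1)
    (hL : ∀ x ∈ X, ∀ x' ∈ X,
      GraphicalBilinearBandit.euclNorm (GraphicalBilinearBandit.edgeArm x x') ≤ L)
    (hS : GraphicalBilinearBandit.frobNorm M ≤ S)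
    (hM : ∀ x ∈ X, ∀ x' ∈ X, 0 ≤ GraphicalBilinearBandit.meanReward M x x')
    (xstar : V → Fin d → ℝ) (hxstar : GraphicalBilinearBandit.IsOptimalJointArm G X M xstar)
    (T : ℕ)
    -- the noise
    {Ω : Type*} [mΩ : MeasurableSpace Ω] (μ : Measure Ω) [IsProbabilityMeasure μ]
    (ℱ : Filtration ℕ mΩ) (η : ℕ → G.Dart → Ω → ℝ)
    (hη : GraphicalBilinearBandit.IsSubgaussianNoise μ ℱ σ T η)
    -- a run of the algorithm, whose choices do not anticipate the noise
    (x x' : ℕ → Ω → Fin d → ℝ)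
    (hx : ∀ t < T, Measurable[ℱ t] (x (t + 1)))
    (hx' : ∀ t < T, Measurable[ℱ t] (x' (t + 1)))
    (hrun : ∀ ω, GraphicalBilinearBandit.IsRun G order X M σ S L lam δ T
      (fun t e => η t e ω) (fun t => x t ω) (fun t => x' t ω))
    (γ α : ℝ) (hγ : γ = GraphicalBilinearBandit.gammaParam G X hX M xstar)
    (hα : α = (1 + γ) / 2) :
    0 ≤ γ ∧ γ ≤ 1 ∧
    ENNReal.ofReal (1 - δ) ≤
      μ {ω | GraphicalBilinearBandit.alphaRegret G M xstar α
          (fun t => GraphicalBilinearBandit.allocate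
            (GraphicalBilinearBandit.approxMaxCut G order) (x t ω) (x' t ω)) T ≤
        GraphicalBilinearBandit.regretBound d (GraphicalBilinearBandit.numEdges G) T
          σ S L lam δ} := by
  subst hγ hα
  refine ⟨GraphicalBilinearBandit.gammaParam_nonneg G hX hM hxstar.1,
    GraphicalBilinearBandit.gammaParam_le_one G hX hM hxstar, ?_⟩
  set P := GraphicalBilinearBandit.approxMaxCut G order with hP
  have hmem : ∀ ω, ∀ t < T, x (t + 1) ω ∈ X ∧ x' (t + 1) ω ∈ X := fun ω t ht =>
    ⟨(hrun ω t ht).1, (hrun ω t ht).2.1⟩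
  refine (GraphicalBilinearBandit.measure_noise_bound (L := L) hσ hlam hδ_pos hδ_le hd hη
    (z := fun ω => GraphicalBilinearBandit.playedArm G P (fun t => x t ω) fun t => x' t ω)
    (fun t ht e => ?_) (fun t ht => ?_) fun ω t ht e => ?_).trans (measure_mono fun ω hω => ?_)
  · have h : ∀ i, Measurable[ℱ t] fun ω =>
        GraphicalBilinearBandit.allocate P (x (t + 1) ω) (x' (t + 1) ω) i := fun i => by
      unfold GraphicalBilinearBandit.allocate
      split_ifs
      exacts [hx t ht, hx' t ht]
    exact GraphicalBilinearBandit.measurable_edgeArm (h e.fst) (h e.snd)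
  -- The edge-arms of a round are determined by a pair in the finite set `X × X`, so the level-set
  -- argument for predictable coefficients applies.
  · refine ((X ×ˢ X).finite_toSet.image fun p (e : G.Dart) =>
      GraphicalBilinearBandit.edgeArm (GraphicalBilinearBandit.allocate P p.1 p.2 e.fst)
        (GraphicalBilinearBandit.allocate P p.1 p.2 e.snd)).subset ?_
    rintro _ ⟨ω, rfl⟩
    exact ⟨(x (t + 1) ω, x' (t + 1) ω), by simpa using hmem ω t ht, rfl⟩
  · exact hL _ (GraphicalBilinearBandit.allocate_mem (hmem ω t ht).1 (hmem ω t ht).2 _) _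
      (GraphicalBilinearBandit.allocate_mem (hmem ω t ht).1 (hmem ω t ht).2 _)
  · refine GraphicalBilinearBandit.alphaRegret_le_regretBound G horder_nodup horder_mem hd hX hσ
      hlam hδ_pos hδ_le hL hS hM hxstar (hrun ω) fun t ht => ?_
    refine GraphicalBilinearBandit.mem_confSet_of_noise_bound hlam (η := fun s e => η s e ω)
      (fun s _ e => ?_) ((GraphicalBilinearBandit.euclNorm_vec M).trans_le hS) (hω t ht.le)
    rw [GraphicalBilinearBandit.playedArm, GraphicalBilinearBandit.edgeArm_dotProduct_vec]
    rfl
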